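/- Let $N\ge 2$ be an integer and let $\ell$ be an integer relatively prime to $N$. For a lattice $L\subset\mathbb C$ and $u\in N^{-1}L$ put $$\Phi(L,u,s)=\sum_{\omega\ne 0,\ \omega/N\equiv u \bmod L}\omega^{-1}|\omega|^{-s}\qquad(\operatorname{Re} s>1).$$ The series converges absolutely and has an analytic continuation to a half-plane containing $s=0$; let $G(L,u)=\Phi(L,u,0)$ be the value of the continuation. For $u,v\in N^{-1}L$ let $\chi^L_u(v)=\exp\bigl(2\pi i N\,(u\wedge v)/\alpha_L\bigr)$, where $\alpha_L$ is the generator of $\bigwedge^2_{\mathbb Z}L$ which is a positive multiple of $1\wedge i\in\bigwedge^2_{\mathbb R}\mathbb C$, and let $$G'(L,u)=\sum_{w\in N^{-1}L/L}\chi^L_u(w)\,G(L,w).$$ For $\tau$ in the upper half plane put $L_\tau=\mathbb Z\cdot 2\pi i+\mathbb Z\cdot 2\pi i\tau$ and $q^{n/N}=e^{2\pi i n\tau/N}$. Let $\{x\}=x-\lfloor x\rfloor$ denote the fractional part, so that $\{\ell/N\}=\ell/N$ if $0<\ell<N$. Below, $m$ runs over all integers, positive or negative, that divide $n$ and are congruent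 to $\ell$ modulo $N$. Then, for every $\tau$ in the upper half plane and with absolutely convergent series, the following hold. (a) $$G'\Bigl(L_\tau,\,2\pi i\,\frac{\ell\tau}{N}\Bigr)=\Bigl(\Bigl\{\frac{\ell}{N}\Bigr\}-\frac12\Bigr)-\sum_{n=1}^\infty\Bigl(\sum_{m\mid n,\ m\equiv \ell}\operatorname{sgn} m\Bigr)q^{n/N}.$$ (b) If $N$ is even, then $$G'\Bigl(L_\tau,\,2\pi i\Bigl(\frac12+\frac{\ell\tau}{N}\Bigr)\Bigr)=\Bigl(\Bigl\{\frac{\ell}{N}\Bigr\}-\frac12\Bigr)-\sum_{n=1}^\infty\Bigl(\sum_{m\mid n,\ m\equiv \ell}(-1)^{n/m}\operatorname{sgn} m\Bigr)q^{n/N}.$$ In particular, the expansion at the cusp $\tau=0$ of the weight one form $f(\tau)=G'(L_\tau,2\pi i\ell/N)$ has rational coefficients: there are rational numbers $c_0,c_1,\dots$ such that $\tau^{-1}f(-1/\tau)=\sum_{n\ge 0}c_n q^{n/N}$ for all $\tau$ in the upper half plane. -/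

import Mathlib

open scoped UpperHalfPlane

noncomputable section

namespace HeckeEisenstein

/-- The lattice `ℤ·2πi + ℤ·2πiτ`. -/
def tateLattice (τ : ℂ) : Submodule ℤ ℂ :=
  Submodule.span ℤ {2 * (Real.pi : ℂ) * Complex.I, 2 * (Real.pi : ℂ) * Complex.I * τ}

/-- The index set of Hecke's series: all `ω ≠ 0` with `ω / N ≡ u mod L`. -/
def HeckeIndex (N : ℕ) (L : Submodule ℤ ℂ) (u : ℂ) : Set ℂ :=
  {ω | ω ≠ 0 ∧ ω / (N : ℂ) - u ∈ L}

/-- `F` is an analytic continuation of `Φ(L, u, s) = ∑' ω⁻¹ |ω|⁻ˢ` (the sum being over the nonzero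
`ω` with `ω / N ≡ u mod L`) from its half-plane of absolute convergence `Re s > 1` to some
half-plane `Re s > σ` that contains the point `s = 0`. -/
def IsHeckeContinuation (N : ℕ) (L : Submodule ℤ ℂ) (u : ℂ) (F : ℂ → ℂ) : Prop :=
  ∃ σ : ℝ, σ < 0 ∧ DifferentiableOn ℂ F {s | σ < s.re} ∧
    ∀ s : ℂ, 1 < s.re →
      HasSum (fun ω : HeckeIndex N L u => (ω : ℂ)⁻¹ * ((‖(ω : ℂ)‖ : ℝ) : ℂ) ^ (-s)) (F s)

open Classical in
/-- Hecke's `G(L, u) = Φ(L, u, 0)`, the value at `s = 0` of the analytic continuation. -/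
def heckeG (N : ℕ) (L : Submodule ℤ ℂ) (u : ℂ) : ℂ :=
  if h : ∃ F, IsHeckeContinuation N L u F then h.choose 0 else 0

/-- Any two continuations agree at `0`, so `heckeG` does not depend on a choice. -/
theorem IsHeckeContinuation.heckeG_eq {N : ℕ} {L : Submodule ℤ ℂ} {u : ℂ} {F : ℂ → ℂ}
    (hF : IsHeckeContinuation N L u F) : heckeG N L u = F 0 := by
  have h : ∃ F, IsHeckeContinuation N L u F := ⟨F, hF⟩
  rw [heckeG, dif_pos h]
  obtain ⟨σ₁, h₁, d₁, s₁⟩ := h.choose_spec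
  obtain ⟨σ₂, h₂, d₂, s₂⟩ := hF
  have ho : IsOpen {s : ℂ | max σ₁ σ₂ < s.re} := isOpen_lt continuous_const Complex.continuous_re
  have hc : IsPreconnected {s : ℂ | max σ₁ σ₂ < s.re} :=
    (convex_halfSpace_re_gt (max σ₁ σ₂)).isPreconnected
  have a₁ : AnalyticOnNhd ℂ h.choose {s : ℂ | max σ₁ σ₂ < s.re} :=
    (d₁.mono fun (s : ℂ) (hs : max σ₁ σ₂ < s.re) =>
      show _ < s.re from lt_of_le_of_lt (le_max_left _ _) hs).analyticOnNhd ho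
  have a₂ : AnalyticOnNhd ℂ F {s : ℂ | max σ₁ σ₂ < s.re} :=
    (d₂.mono fun (s : ℂ) (hs : max σ₁ σ₂ < s.re) =>
      show _ < s.re from lt_of_le_of_lt (le_max_right _ _) hs).analyticOnNhd ho
  have hm : max σ₁ σ₂ < 0 := max_lt h₁ h₂
  refine a₁.eqOn_of_preconnected_of_eventuallyEq a₂ hc (z₀ := 2) ?_ ?_ (by simpa using hm)
  · simp only [Set.mem_ofPred_eq, Complex.re_ofNat]; linarith
  · have ho' : IsOpen {s : ℂ | 1 < s.re} := isOpen_lt continuous_const Complex.continuous_re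
    filter_upwards [ho'.mem_nhds (show (2 : ℂ) ∈ {s : ℂ | 1 < s.re} by simp)] with s hs
    exact (s₁ s hs).unique (s₂ s hs)

/-- The coordinate of `x ∧ y ∈ ⋀²_ℝ ℂ` with respect to the basis `1 ∧ i`. -/
def wedge (x y : ℂ) : ℝ := x.re * y.im - x.im * y.re

/-- The coordinate with respect to `1 ∧ i` of the generator `α_L` of `⋀²_ℤ L` that is a positive
multiple of `1 ∧ i`. Every element of `⋀²_ℤ L` is of the form `x ∧ y` with `x, y ∈ L` because
`L` has rank two, so this is the least positive value of `x ∧ y`. -/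
def latticeOrientation (L : Submodule ℤ ℂ) : ℝ :=
  sInf {r : ℝ | 0 < r ∧ ∃ x ∈ L, ∃ y ∈ L, wedge x y = r}

/-- The character `χ^L_u(v) = exp(2πi N (u ∧ v) / α_L)`, for `u, v ∈ N⁻¹L`. -/
def latticeChar (N : ℕ) (L : Submodule ℤ ℂ) (u v : ℂ) : ℂ :=
  Complex.exp (2 * (Real.pi : ℂ) * Complex.I *
    (((N : ℝ) * (wedge u v / latticeOrientation L) : ℝ) : ℂ))

/-- `G'(L, u) = ∑ χ^L_u(w) G(L, w)`, over `w ∈ N⁻¹L / L`, that is, over the `N`-torsion classes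
`c` of `ℂ / L` (each term depends only on the class of `w` when `u ∈ N⁻¹L`). -/
def heckeG' (N : ℕ) (L : Submodule ℤ ℂ) (u : ℂ) : ℂ :=
  ∑ᶠ c : {c : ℂ ⧸ L // (N : ℤ) • c = 0},
    latticeChar N L u (Quotient.out c.1) * heckeG N L (Quotient.out c.1)

/-- The integers `m`, positive or negative, with `m ∣ n` and `m ≡ ℓ mod N` (for `n ≥ 1`). -/
def divisorsCongr (N : ℕ) (ℓ : ℤ) (n : ℕ) : Finset ℤ :=
  (Finset.Icc (-(n : ℤ)) n).filter fun m => m ∣ (n : ℤ) ∧ m ≡ ℓ [ZMOD N]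

end HeckeEisenstein

end

/-! Let `ψ` be a unitary character of the lattice. Abel summation along a lattice vector `v₀` with
`ψ(v₀) ≠ 1` replaces `ω⁻¹|ω|⁻ˢ` in the twisted series `∑ ψ(ω) ω⁻¹|ω|⁻ˢ` by its second difference,
of size `|ω|⁻³⁻ˢ`, which continues the series to `Re s > -1`; for `ψ = 1` the series is zero because
its terms are odd. Hecke's series are combinations of these by orthogonality of characters, and `G'`
is the value at `s = 0` of a single one, namely with `ψ = χ_u` pulled back along `ω ↦ ω/N`.

Write `ω = ω₁(dτ + c)`, `x = {ℓ/N}`, and take `v₀ = ω₁`. At `s = 0` the sum over `c` is, up to Abel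
summation, the Fourier series in `x` of `2πi e(xdτ) / (e(dτ) - 1)` (of `2πi (x - 1/2)` for `d = 0`),
where `e(z) = exp(2πiz)`. Expanding it as a geometric series, in powers of `e(dτ)` or of `e(-dτ)`
according to the sign of `d`, gives exponents `dm/N` with `m ≡ ℓ` modulo `N` of the same sign as
`d`, and collecting the pairs with `dm = n` gives the `q`-expansion. The cusp `0` is the same
expansion, since `L_{-1/τ}` is the lattice spanned by `2πi/τ` and `2πi`.
-/

noncomputable section

namespace HeckeEisenstein

section ForwardDifference

theorem fwdDiff_iter_comp_of_map_add {M M' G : Type*} [AddCommMonoid M] [AddCommMonoid M']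
    [AddCommGroup G] {P : M → M'} {h : M} {h' : M'} (hP : ∀ v, P (v + h) = P v + h') (f : M' → G)
    (n : ℕ) : (fwdDiff h)^[n] (f ∘ P) = (fwdDiff h')^[n] f ∘ P := by
  induction n with
  | zero => rfl
  | succ n ih =>
    rw [Function.iterate_succ_apply', Function.iterate_succ_apply', ih]
    ext v
    simp only [fwdDiff, Function.comp_apply, hP]

theorem hasSum_addChar_mul_fwdDiff_iter {A : Type*} [AddCommGroup A] {ψ : AddChar A ℂ} {g : A → ℂ}
    {S : ℂ} (hg : HasSum (fun v => ψ v * g v) S) (v₀ : A) (n : ℕ) :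
    HasSum (fun v => ψ v * (fwdDiff v₀)^[n] g v) ((ψ (-v₀) - 1) ^ n * S) := by
  induction n with
  | zero => simpa using hg
  | succ n ih =>
    have hshift : HasSum (fun v => ψ v * (fwdDiff v₀)^[n] g (v + v₀))
        (ψ (-v₀) * ((ψ (-v₀) - 1) ^ n * S)) := by
      refine (((Equiv.addRight v₀).hasSum_iff.2 ih).mul_left (ψ (-v₀))).congr_fun fun v => ?_
      rw [Function.comp_apply, Equiv.coe_addRight, ← mul_assoc, ← AddChar.map_add_eq_mul,
        neg_add_cancel_comm_assoc]
    have hdiff := (hshift.sub ih).congr_fun fun v => by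
      rw [← mul_sub, ← fwdDiff, ← Function.iterate_succ_apply' (fwdDiff v₀)]
    rwa [← sub_one_mul, ← mul_assoc, ← pow_succ'] at hdiff

theorem norm_fwdDiff_le_of_hasDerivAt {E : Type*} [NormedAddCommGroup E] [NormedSpace ℝ E]
    {f f' : ℝ → E} {a C : ℝ} (hf : ∀ t ∈ Set.Icc a (a + 1), HasDerivAt f (f' t) t)
    (hC : ∀ t ∈ Set.Icc a (a + 1), ‖f' t‖ ≤ C) : ‖fwdDiff 1 f a‖ ≤ C := by
  have hle : a ≤ a + 1 := by linarith
  simpa [fwdDiff] using Convex.norm_image_sub_le_of_norm_hasDerivWithin_le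
    (fun t ht => (hf t ht).hasDerivWithinAt) hC (convex_Icc a (a + 1))
    (Set.left_mem_Icc.2 hle) (Set.right_mem_Icc.2 hle)

theorem norm_fwdDiff_iter_two_le_of_hasDerivAt {E : Type*} [NormedAddCommGroup E]
    [NormedSpace ℝ E] {f f' f'' : ℝ → E} {a C : ℝ}
    (hf : ∀ t ∈ Set.Icc a (a + 2), HasDerivAt f (f' t) t)
    (hf' : ∀ t ∈ Set.Icc a (a + 2), HasDerivAt f' (f'' t) t)
    (hC : ∀ t ∈ Set.Icc a (a + 2), ‖f'' t‖ ≤ C) : ‖(fwdDiff 1)^[2] f a‖ ≤ C := by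
  refine norm_fwdDiff_le_of_hasDerivAt (f' := fwdDiff 1 f') (fun t ht => ?_) fun t ht => ?_
  · exact ((hf (t + 1) ⟨by linarith [ht.1], by linarith [ht.2]⟩).comp_add_const t 1).sub
      (hf t ⟨ht.1, by linarith [ht.2]⟩)
  · exact norm_fwdDiff_le_of_hasDerivAt
      (fun u hu => hf' u ⟨ht.1.trans hu.1, by linarith [hu.2, ht.2]⟩)
      (fun u hu => hC u ⟨ht.1.trans hu.1, by linarith [hu.2, ht.2]⟩)

end ForwardDifference

section HeckeTerm

/-- The summand `z⁻¹ |z|⁻ˢ` of Hecke's series; it vanishes at `z = 0`. -/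
def heckeTerm (s z : ℂ) : ℂ := z⁻¹ * ((‖z‖ : ℝ) : ℂ) ^ (-s)

@[simp] theorem heckeTerm_zero_right (s : ℂ) : heckeTerm s 0 = 0 := by simp [heckeTerm]

@[simp] theorem heckeTerm_zero_left (z : ℂ) : heckeTerm 0 z = z⁻¹ := by simp [heckeTerm]

theorem heckeTerm_neg (s z : ℂ) : heckeTerm s (-z) = -heckeTerm s z := by
  simp [heckeTerm, inv_neg]

theorem heckeTerm_eq_exp (s : ℂ) {z : ℂ} (hz : z ≠ 0) :
    heckeTerm s z = z⁻¹ * Complex.exp (-s * (Real.log ‖z‖ : ℝ)) := by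
  have : ((‖z‖ : ℝ) : ℂ) ≠ 0 := by simpa using hz
  rw [heckeTerm, Complex.cpow_def_of_ne_zero this, Complex.ofReal_log (norm_nonneg z),
    mul_comm (-s)]

theorem norm_heckeTerm (s : ℂ) {z : ℂ} (hz : z ≠ 0) :
    ‖heckeTerm s z‖ = ‖z‖ ^ (-(1 + s.re)) := by
  have h : 0 < ‖z‖ := norm_pos_iff.2 hz
  rw [heckeTerm, norm_mul, norm_inv, Complex.norm_cpow_eq_rpow_re_of_pos h, neg_add,
    Real.rpow_add h, Real.rpow_neg_one, Complex.neg_re]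

theorem differentiable_heckeTerm (z : ℂ) : Differentiable ℂ fun s => heckeTerm s z := by
  rcases eq_or_ne z 0 with rfl | hz
  · simp
  · simp only [heckeTerm_eq_exp _ hz]
    fun_prop

theorem hasDerivAt_line (z h : ℂ) (t : ℝ) : HasDerivAt (fun t : ℝ => z + t * h) h t := by
  simpa using ((Complex.ofRealCLM.hasDerivAt (x := t)).mul_const h).const_add z

theorem hasDerivAt_log_norm_line {z h : ℂ} {t : ℝ} (hw : z + t * h ≠ 0) :
    HasDerivAt (fun t : ℝ => Real.log ‖z + t * h‖) (h / (z + t * h)).re t := by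
  have hlog := ((hasDerivAt_line z h t).norm_sq.log (by simpa using hw)).div_const 2
  have hw' : ‖z + t * h‖ ≠ 0 := by simpa using hw
  refine (hlog.congr_deriv ?_).congr_of_eventuallyEq (.of_forall fun t => ?_)
  · rw [Complex.div_re, Complex.normSq_eq_norm_sq, Complex.inner]
    simp only [Complex.mul_re, Complex.conj_re, Complex.conj_im]
    field_simp
    ring
  · simp only [Real.log_pow]
    push_cast
    ring

/-- The logarithmic derivative of `t ↦ heckeTerm s (z + t h)` is `-logDerivTerm s (h / (z + t h))`.
-/
def logDerivTerm (s η : ℂ) : ℂ := η + s * (η.re : ℂ)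

theorem norm_logDerivTerm_le (s η : ℂ) : ‖logDerivTerm s η‖ ≤ (1 + ‖s‖) * ‖η‖ := by
  have hre : ‖(η.re : ℂ)‖ ≤ ‖η‖ := by simpa using Complex.abs_re_le_norm η
  calc ‖logDerivTerm s η‖ ≤ ‖η‖ + ‖s‖ * ‖(η.re : ℂ)‖ := by
        rw [logDerivTerm, ← norm_mul]; exact norm_add_le _ _
    _ ≤ ‖η‖ + ‖s‖ * ‖η‖ := by gcongr
    _ = _ := by ring

theorem hasDerivAt_heckeTerm_line (s : ℂ) {z h : ℂ} {t : ℝ} (hw : z + t * h ≠ 0) :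
    HasDerivAt (fun t : ℝ => heckeTerm s (z + t * h))
      (-(heckeTerm s (z + t * h) * logDerivTerm s (h / (z + t * h)))) t := by
  have hline := hasDerivAt_line z h t
  have hprod := (hline.fun_inv hw).mul
    (((hasDerivAt_log_norm_line hw).ofReal_comp).const_mul (-s)).cexp
  have hne : ∀ᶠ t' : ℝ in nhds t, z + t' * h ≠ 0 := hline.continuousAt.eventually_ne hw
  refine (hprod.congr_deriv ?_).congr_of_eventuallyEq (hne.mono fun t' ht => ?_)
  · rw [heckeTerm_eq_exp _ hw, logDerivTerm]
    generalize Complex.exp _ = e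
    generalize (h / (z + t * h)).re = r
    generalize z + t * h = w at hw ⊢
    field_simp
    ring
  · simpa using heckeTerm_eq_exp s ht

theorem hasDerivAt_logDerivTerm_line (s : ℂ) {z h : ℂ} {t : ℝ} (hw : z + t * h ≠ 0) :
    HasDerivAt (fun t : ℝ => logDerivTerm s (h / (z + t * h)))
      (-logDerivTerm s ((h / (z + t * h)) ^ 2)) t := by
  have hquot : HasDerivAt (fun t : ℝ => h / (z + t * h)) (-(h / (z + t * h)) ^ 2) t := by
    refine ((hasDerivAt_const t h).fun_div (hasDerivAt_line z h t) hw).congr_deriv ?_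
    field_simp
    ring
  have hre : HasDerivAt (fun t : ℝ => (h / (z + t * h)).re) (-(h / (z + t * h)) ^ 2).re t :=
    Complex.reCLM.hasFDerivAt.comp_hasDerivAt t hquot
  refine (hquot.add (hre.ofReal_comp.const_mul s)).congr_deriv ?_
  simp only [logDerivTerm, Complex.neg_re, Complex.ofReal_neg]
  ring

theorem hasDerivAt_heckeTerm_mul_logDerivTerm_line (s : ℂ) {z h : ℂ} {t : ℝ}
    (hw : z + t * h ≠ 0) :
    HasDerivAt (fun t : ℝ => -(heckeTerm s (z + t * h) * logDerivTerm s (h / (z + t * h))))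
      (heckeTerm s (z + t * h) *
        (logDerivTerm s (h / (z + t * h)) ^ 2 + logDerivTerm s ((h / (z + t * h)) ^ 2))) t := by
  refine ((hasDerivAt_heckeTerm_line s hw).mul
    (hasDerivAt_logDerivTerm_line s hw)).fun_neg.congr_deriv ?_
  ring

theorem norm_heckeTerm_mul_logDerivTerm_le (s : ℂ) {w h : ℂ} (hw : w ≠ 0) :
    ‖heckeTerm s w * (logDerivTerm s (h / w) ^ 2 + logDerivTerm s ((h / w) ^ 2))‖ ≤
      2 * (1 + ‖s‖) ^ 2 * ‖h‖ ^ 2 * ‖w‖ ^ (-(3 + s.re)) := by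
  have hp : 0 < ‖w‖ := norm_pos_iff.2 hw
  have hlog : ‖logDerivTerm s (h / w) ^ 2 + logDerivTerm s ((h / w) ^ 2)‖ ≤
      2 * (1 + ‖s‖) ^ 2 * ‖h / w‖ ^ 2 := by
    calc _ ≤ ‖logDerivTerm s (h / w)‖ ^ 2 + ‖logDerivTerm s ((h / w) ^ 2)‖ := by
          rw [← norm_pow]; exact norm_add_le _ _
      _ ≤ ((1 + ‖s‖) * ‖h / w‖) ^ 2 + (1 + ‖s‖) * ‖(h / w) ^ 2‖ := by
          gcongr <;> exact norm_logDerivTerm_le _ _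
      _ = ((1 + ‖s‖) ^ 2 + (1 + ‖s‖)) * ‖h / w‖ ^ 2 := by rw [norm_pow]; ring
      _ ≤ _ := by
          gcongr
          nlinarith [norm_nonneg s]
  have hpow : ‖w‖ ^ (-(3 + s.re)) = ‖w‖ ^ (-(1 + s.re)) * (‖w‖ ^ 2)⁻¹ := by
    rw [show -(3 + s.re) = -(1 + s.re) + -(2 : ℕ) by push_cast; ring, Real.rpow_add hp,
      Real.rpow_neg hp.le (2 : ℕ), Real.rpow_natCast]
  rw [norm_mul, norm_heckeTerm s hw, hpow]
  calc _ ≤ ‖w‖ ^ (-(1 + s.re)) * (2 * (1 + ‖s‖) ^ 2 * ‖h / w‖ ^ 2) := by gcongr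
    _ = _ := by rw [norm_div]; field_simp

theorem norm_fwdDiff_iter_two_heckeTerm_le {s z h : ℂ} (hs : -3 ≤ s.re) (hz : z ≠ 0)
    (hh : 4 * ‖h‖ ≤ ‖z‖) :
    ‖(fwdDiff h)^[2] (heckeTerm s) z‖ ≤
      2 * (1 + ‖s‖) ^ 2 * ‖h‖ ^ 2 * (‖z‖ / 2) ^ (-(3 + s.re)) := by
  have hpos : 0 < ‖z‖ / 2 := by positivity
  have hline : ∀ t ∈ Set.Icc (0 : ℝ) (0 + 2), ‖z‖ / 2 ≤ ‖z + t * h‖ := fun t ht => by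
    have hth : ‖(t : ℂ) * h‖ ≤ 2 * ‖h‖ := by
      rw [norm_mul, Complex.norm_real, Real.norm_of_nonneg ht.1]
      gcongr
      linarith [ht.2]
    linarith [norm_sub_le_norm_add z ((t : ℂ) * h)]
  have hne : ∀ t ∈ Set.Icc (0 : ℝ) (0 + 2), z + t * h ≠ 0 := fun t ht =>
    norm_pos_iff.1 (hpos.trans_le (hline t ht))
  have hrestrict : (fwdDiff 1)^[2] (fun t : ℝ => heckeTerm s (z + t * h)) 0 =
      (fwdDiff h)^[2] (heckeTerm s) (z + (0 : ℝ) * h) :=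
    congr_fun (fwdDiff_iter_comp_of_map_add (P := fun t : ℝ => z + t * h)
      (fun t => by push_cast; ring) (heckeTerm s) 2) 0
  rw [Complex.ofReal_zero, zero_mul, add_zero] at hrestrict
  rw [← hrestrict]
  refine norm_fwdDiff_iter_two_le_of_hasDerivAt
    (fun t ht => hasDerivAt_heckeTerm_line s (hne t ht))
    (fun t ht => hasDerivAt_heckeTerm_mul_logDerivTerm_line s (hne t ht)) fun t ht => ?_
  refine (norm_heckeTerm_mul_logDerivTerm_le s (hne t ht)).trans ?_
  gcongr 2 * (1 + ‖s‖) ^ 2 * ‖h‖ ^ 2 * ?_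
  exact Real.rpow_le_rpow_of_nonpos hpos (hline t ht) (by linarith)

end HeckeTerm

section Lattice

/-- The parametrization `(d, c) ↦ ω₁ (d τ + c)` of the lattice spanned by `ω₁ τ` and `ω₁`. -/
def latticePoint (ω₁ τ : ℂ) : ℤ × ℤ →ₗ[ℤ] ℂ :=
  (LinearMap.toSpanSingleton ℤ ℂ (ω₁ * τ)).coprod (LinearMap.toSpanSingleton ℤ ℂ ω₁)

theorem latticePoint_apply (ω₁ τ : ℂ) (v : ℤ × ℤ) :
    latticePoint ω₁ τ v = ω₁ * (v.1 * τ + v.2) := by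
  simp only [latticePoint, LinearMap.coprod_apply, LinearMap.toSpanSingleton_apply,
    zsmul_eq_mul]
  ring

/-- The lattice `ℤ·ω₁ + ℤ·ω₁τ`. -/
def periodLattice (ω₁ τ : ℂ) : Submodule ℤ ℂ := LinearMap.range (latticePoint ω₁ τ)

theorem mem_periodLattice {ω₁ τ z : ℂ} : z ∈ periodLattice ω₁ τ ↔ ∃ v, latticePoint ω₁ τ v = z :=
  LinearMap.mem_range

theorem latticePoint_mem_periodLattice (ω₁ τ : ℂ) (v : ℤ × ℤ) :
    latticePoint ω₁ τ v ∈ periodLattice ω₁ τ :=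
  LinearMap.mem_range_self _ v

theorem periodLattice_eq_span (ω₁ τ : ℂ) :
    periodLattice ω₁ τ = Submodule.span ℤ {ω₁, ω₁ * τ} := by
  rw [periodLattice, latticePoint, LinearMap.range_coprod, ← LinearMap.span_singleton_eq_range,
    ← LinearMap.span_singleton_eq_range, Submodule.span_insert, sup_comm]

theorem tateLattice_eq_periodLattice (τ : ℂ) :
    tateLattice τ = periodLattice (2 * Real.pi * Complex.I) τ :=
  (periodLattice_eq_span _ τ).symm

theorem tateLattice_neg_one_div {τ : ℂ} (hτ : τ ≠ 0) :
    tateLattice (-1 / τ) = periodLattice (2 * Real.pi * Complex.I / τ) τ := by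
  rw [tateLattice, periodLattice_eq_span, div_mul_cancel₀ _ hτ, mul_div_assoc', mul_neg_one,
    neg_div, Set.pair_comm, Submodule.span_insert, Submodule.span_insert, ← Set.neg_singleton,
    Submodule.span_neg]

variable {ω₁ : ℂ} (hω₁ : ω₁ ≠ 0) (τ : ℍ)
include hω₁

theorem latticePoint_injective : Function.Injective (latticePoint ω₁ τ) := by
  refine (injective_iff_map_eq_zero _).2 fun v hv => ?_
  have hv : (v.1 : ℂ) * τ + v.2 = 0 :=
    (mul_eq_zero.1 ((latticePoint_apply _ _ v).symm.trans hv)).resolve_left hω₁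
  have hd : v.1 = 0 := by simpa [τ.im_ne_zero] using congrArg Complex.im hv
  have hc : v.2 = 0 := by simpa [hd] using hv
  exact Prod.ext hd hc

theorem latticePoint_ne_zero {v : ℤ × ℤ} (hv : v ≠ 0) : latticePoint ω₁ τ v ≠ 0 :=
  (map_ne_zero_iff _ (latticePoint_injective hω₁ τ)).2 hv

theorem summable_norm_latticePoint_rpow {k : ℝ} (hk : 2 < k) :
    Summable fun v => ‖latticePoint ω₁ τ v‖ ^ (-k) := by
  rw [← (finTwoArrowEquiv ℤ).summable_iff]
  refine Summable.of_nonneg_of_le (fun x => Real.rpow_nonneg (norm_nonneg _) _) (fun x => ?_)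
    ((EisensteinSeries.summable_one_div_norm_rpow hk).mul_left
      (‖ω₁‖ ^ (-k) * EisensteinSeries.r τ ^ (-k)))
  have hbound := EisensteinSeries.summand_bound τ (by linarith : 0 ≤ k) x
  have hx : ‖latticePoint ω₁ τ (finTwoArrowEquiv ℤ x)‖ = ‖ω₁‖ * ‖(x 0 : ℂ) * τ + x 1‖ := by
    rw [latticePoint_apply, norm_mul]
    rfl
  rw [Function.comp, hx, Real.mul_rpow (norm_nonneg _) (norm_nonneg _), mul_assoc]
  exact mul_le_mul_of_nonneg_left hbound (by positivity)

theorem eventually_cofinite_le_norm_latticePoint (R : ℝ) :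
    ∀ᶠ v in Filter.cofinite, R ≤ ‖latticePoint ω₁ τ v‖ := by
  have hlim := (summable_norm_latticePoint_rpow hω₁ τ
    (k := 3) (by norm_num)).tendsto_cofinite_zero
  have hpos : (0 : ℝ) < max R 1 ^ (-3 : ℝ) := by positivity
  filter_upwards [hlim.eventually (gt_mem_nhds hpos), (Set.finite_singleton 0).compl_mem_cofinite]
    with v hv hv0
  have hnorm : 0 < ‖latticePoint ω₁ τ v‖ := norm_pos_iff.2 (latticePoint_ne_zero hω₁ τ hv0)
  exact (le_max_left R 1).trans
    ((Real.rpow_lt_rpow_iff_of_neg hnorm (by positivity) (by norm_num)).1 hv).le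

end Lattice

section Continuation

theorem tsum_eq_zero_of_odd {A : Type*} [InvolutiveNeg A] {f : A → ℂ} (hf : f.Odd) :
    ∑' v, f v = 0 := by
  refine self_eq_neg.1 ?_
  rw [← tsum_neg, ← (Equiv.neg A).tsum_eq f]
  exact tsum_congr hf

theorem differentiable_fwdDiff_iter_heckeTerm (h : ℂ) (n : ℕ) (z : ℂ) :
    Differentiable ℂ fun s => (fwdDiff h)^[n] (heckeTerm s) z := by
  simp only [fwdDiff_iter_eq_sum_shift]
  exact .fun_sum fun k _ => (differentiable_heckeTerm _).const_smul _

/-- `F` continues `∑' φ v ω⁻¹ |ω|⁻ˢ`, where `ω = latticePoint ω₁ τ v`, from the half-plane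
`Re s > 1` of absolute convergence (for bounded `φ`) to `Re s > -1`. -/
structure IsTwistedContinuation (ω₁ τ : ℂ) (φ : ℤ × ℤ → ℂ) (F : ℂ → ℂ) : Prop where
  differentiableOn : DifferentiableOn ℂ F {s | -1 < s.re}
  hasSum : ∀ s : ℂ, 1 < s.re → HasSum (fun v => φ v * heckeTerm s (latticePoint ω₁ τ v)) (F s)

namespace IsTwistedContinuation

variable {ω₁ τ : ℂ} {φ : ℤ × ℤ → ℂ} {F : ℂ → ℂ}

theorem const_mul (h : IsTwistedContinuation ω₁ τ φ F) (a : ℂ) :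
    IsTwistedContinuation ω₁ τ (fun v => a * φ v) fun s => a * F s where
  differentiableOn := h.differentiableOn.const_mul a
  hasSum s hs := by simpa only [mul_assoc] using (h.hasSum s hs).mul_left a

theorem sum {ι : Type*} {t : Finset ι} {φ : ι → ℤ × ℤ → ℂ} {F : ι → ℂ → ℂ}
    (h : ∀ i ∈ t, IsTwistedContinuation ω₁ τ (φ i) (F i)) :
    IsTwistedContinuation ω₁ τ (fun v => ∑ i ∈ t, φ i v) fun s => ∑ i ∈ t, F i s where
  differentiableOn := DifferentiableOn.fun_sum fun i hi => (h i hi).differentiableOn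
  hasSum s hs := by
    simpa only [Finset.sum_mul] using hasSum_sum fun i hi => (h i hi).hasSum s hs

theorem apply_zero_eq {G : ℂ → ℂ} (hF : IsTwistedContinuation ω₁ τ φ F)
    (hG : IsTwistedContinuation ω₁ τ φ G) : F 0 = G 0 := by
  have hopen (a : ℝ) : IsOpen {s : ℂ | a < s.re} :=
    isOpen_lt continuous_const Complex.continuous_re
  have heq : F =ᶠ[nhds 2] G := by
    filter_upwards [(hopen 1).mem_nhds (by simp : (2 : ℂ) ∈ {s : ℂ | 1 < s.re})] with s hs
    exact (hF.hasSum s hs).unique (hG.hasSum s hs)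
  refine (hF.differentiableOn.analyticOnNhd (hopen _)).eqOn_of_preconnected_of_eventuallyEq
    (hG.differentiableOn.analyticOnNhd (hopen _)) (convex_halfSpace_re_gt _).isPreconnected
    (z₀ := 2) ?_ heq (by simp)
  simp only [Set.mem_ofPred_eq, Complex.re_ofNat]
  norm_num

end IsTwistedContinuation

variable {ω₁ : ℂ} (hω₁ : ω₁ ≠ 0) (τ : ℍ)
include hω₁

theorem summable_mul_heckeTerm {s : ℂ} (hs : 1 < s.re) {φ : ℤ × ℤ → ℂ} {B : ℝ}
    (hφ : ∀ v, ‖φ v‖ ≤ B) : Summable fun v => φ v * heckeTerm s (latticePoint ω₁ τ v) := by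
  refine Summable.of_norm_bounded ((summable_norm_latticePoint_rpow hω₁ τ
    (k := 1 + s.re) (by linarith)).mul_left B) fun v => ?_
  rw [norm_mul]
  refine mul_le_mul (hφ v) ?_ (norm_nonneg _) ((norm_nonneg _).trans (hφ v))
  rcases eq_or_ne (latticePoint ω₁ τ v) 0 with h | h
  · rw [h, heckeTerm_zero_right, norm_zero]; positivity
  · rw [norm_heckeTerm s h]

theorem isTwistedContinuation_one : IsTwistedContinuation ω₁ τ (fun _ => 1) fun _ => 0 where
  differentiableOn := differentiableOn_const 0
  hasSum s hs := by
    have hsum := summable_mul_heckeTerm hω₁ τ hs (φ := fun _ => 1) (B := 1) (by simp)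
    have hodd : (fun v => (1 : ℂ) * heckeTerm s (latticePoint ω₁ τ v)).Odd := fun v => by
      simp [heckeTerm_neg]
    simpa only [tsum_eq_zero_of_odd hodd] using hsum.hasSum

theorem exists_summable_bound_fwdDiff_iter_two_heckeTerm (h : ℂ) {σ : ℝ} (hσ : -1 < σ) (R : ℝ) :
    ∃ u : ℤ × ℤ → ℝ, Summable u ∧ ∀ v, ∀ s : ℂ, σ ≤ s.re → ‖s‖ ≤ R →
      ‖(fwdDiff h)^[2] (heckeTerm s) (latticePoint ω₁ τ v)‖ ≤ u v := by
  have hcompact (v : ℤ × ℤ) : ∃ C, ∀ s ∈ Metric.closedBall (0 : ℂ) R,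
      ‖(fwdDiff h)^[2] (heckeTerm s) (latticePoint ω₁ τ v)‖ ≤ C :=
    (isCompact_closedBall (0 : ℂ) R).exists_bound_of_continuousOn
      (differentiable_fwdDiff_iter_heckeTerm h 2 _).continuous.continuousOn
  choose C hC using hcompact
  set M : ℝ := max 2 (4 * ‖h‖)
  set u : ℤ × ℤ → ℝ := fun v =>
    2 * (1 + R) ^ 2 * ‖h‖ ^ 2 * (‖latticePoint ω₁ τ v‖ / 2) ^ (-(3 + σ))
  have hu : Summable u := by
    simp only [u, Real.div_rpow (norm_nonneg _) zero_le_two]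
    exact ((summable_norm_latticePoint_rpow hω₁ τ (by linarith)).div_const _).mul_left _
  refine ⟨fun v => if M ≤ ‖latticePoint ω₁ τ v‖ then u v else C v, hu.congr_cofinite ?_, ?_⟩
  · filter_upwards [eventually_cofinite_le_norm_latticePoint hω₁ τ M] with v hv
    exact (if_pos hv).symm
  · intro v s hs hR
    dsimp only
    split_ifs with hv
    · have hz : 2 ≤ ‖latticePoint ω₁ τ v‖ := (le_max_left _ _).trans hv
      refine (norm_fwdDiff_iter_two_heckeTerm_le (by linarith) (norm_pos_iff.1 (by linarith))
        ((le_max_right _ _).trans hv)).trans ?_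
      have hbase : 1 ≤ ‖latticePoint ω₁ τ v‖ / 2 := by linarith
      simp only [u]
      gcongr
    · exact hC v s (by simpa using hR)

variable {ψ : AddChar (ℤ × ℤ) ℂ} (hψ : ∀ v, ‖ψ v‖ = 1)
include hψ

theorem summable_addChar_mul_fwdDiff_iter_two_heckeTerm (h : ℂ) {s : ℂ} (hs : -1 < s.re) :
    Summable fun v => ψ v * (fwdDiff h)^[2] (heckeTerm s) (latticePoint ω₁ τ v) := by
  obtain ⟨u, hu, hbound⟩ :=
    exists_summable_bound_fwdDiff_iter_two_heckeTerm hω₁ τ h hs ‖s‖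
  refine hu.of_norm_bounded fun v => ?_
  rw [norm_mul, hψ, one_mul]
  exact hbound v s le_rfl le_rfl

theorem differentiableOn_tsum_addChar_mul_fwdDiff_iter_two_heckeTerm (h : ℂ) :
    DifferentiableOn ℂ
      (fun s => ∑' v, ψ v * (fwdDiff h)^[2] (heckeTerm s) (latticePoint ω₁ τ v))
      {s | -1 < s.re} := by
  intro s₀ (hs₀ : -1 < s₀.re)
  obtain ⟨σ, hσ, hσs₀⟩ := exists_between hs₀
  obtain ⟨u, hu, hbound⟩ :=
    exists_summable_bound_fwdDiff_iter_two_heckeTerm hω₁ τ h hσ (‖s₀‖ + 1)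
  have hopen : IsOpen ({s : ℂ | σ < s.re} ∩ Metric.ball 0 (‖s₀‖ + 1)) :=
    (isOpen_lt continuous_const Complex.continuous_re).inter Metric.isOpen_ball
  have hdiff := Complex.differentiableOn_tsum_of_summable_norm hu
    (fun v => ((differentiable_fwdDiff_iter_heckeTerm h 2 (latticePoint ω₁ τ v)).const_mul
      (ψ v)).differentiableOn) hopen fun v s hs => by
      rw [norm_mul, hψ, one_mul]
      exact hbound v s (le_of_lt hs.1) (mem_ball_zero_iff.1 hs.2).le
  exact (hdiff.differentiableAt (hopen.mem_nhds ⟨hσs₀, by simp⟩)).differentiableWithinAt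

theorem isTwistedContinuation_addChar {v₀ : ℤ × ℤ} (hv₀ : ψ v₀ ≠ 1) :
    IsTwistedContinuation ω₁ τ ψ fun s => ((ψ (-v₀) - 1) ^ 2)⁻¹ *
      ∑' v, ψ v * (fwdDiff (latticePoint ω₁ τ v₀))^[2] (heckeTerm s) (latticePoint ω₁ τ v) where
  differentiableOn := (differentiableOn_tsum_addChar_mul_fwdDiff_iter_two_heckeTerm
    hω₁ τ hψ _).const_mul _
  hasSum s hs := by
    have hne : (ψ (-v₀) - 1) ^ 2 ≠ 0 := by
      rw [AddChar.map_neg_eq_inv]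
      exact pow_ne_zero 2 (sub_ne_zero.2 (inv_ne_one.2 hv₀))
    have hterm := (summable_mul_heckeTerm hω₁ τ hs fun v => (hψ v).le).hasSum
    have habel := hasSum_addChar_mul_fwdDiff_iter hterm v₀ 2
    have hcomp := fwdDiff_iter_comp_of_map_add
      (fun v => map_add (latticePoint ω₁ τ) v v₀) (heckeTerm s) 2
    simp only [← Function.comp_apply (f := heckeTerm s), hcomp] at habel
    simp only [Function.comp_apply] at habel
    rw [habel.tsum_eq, inv_mul_cancel_left₀ hne]
    exact hterm

theorem exists_isTwistedContinuation_addChar : ∃ F, IsTwistedContinuation ω₁ τ ψ F := by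
  by_cases h : ∃ v₀, ψ v₀ ≠ 1
  · obtain ⟨v₀, hv₀⟩ := h
    exact ⟨_, isTwistedContinuation_addChar hω₁ τ hψ hv₀⟩
  · push Not at h
    exact ⟨_, funext h ▸ isTwistedContinuation_one hω₁ τ⟩

end Continuation

section Exponential

/-- The additive character `z ↦ exp(2πiz)` of `ℂ`. -/
def expTwoPiI : AddChar ℂ ℂ where
  toFun z := Complex.exp (2 * Real.pi * Complex.I * z)
  map_zero_eq_one' := by simp
  map_add_eq_mul' z w := by rw [mul_add, Complex.exp_add]

theorem expTwoPiI_apply (z : ℂ) : expTwoPiI z = Complex.exp (2 * Real.pi * Complex.I * z) := rfl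

theorem expTwoPiI_eq_one_iff {z : ℂ} : expTwoPiI z = 1 ↔ ∃ n : ℤ, z = n := by
  rw [expTwoPiI_apply, Complex.exp_eq_one_iff]
  refine exists_congr fun n => ?_
  rw [mul_comm, mul_left_inj' Complex.two_pi_I_ne_zero]

@[simp] theorem expTwoPiI_intCast (n : ℤ) : expTwoPiI n = 1 := expTwoPiI_eq_one_iff.2 ⟨n, rfl⟩

theorem expTwoPiI_one_half_mul (j : ℤ) : expTwoPiI ((1 / 2 : ℝ) * j) = (-1) ^ j := by
  rw [expTwoPiI_apply, ← Complex.exp_pi_mul_I, ← Complex.exp_int_mul]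
  push_cast
  ring_nf

theorem norm_expTwoPiI (z : ℂ) : ‖expTwoPiI z‖ = Real.exp (-2 * Real.pi * z.im) := by
  rw [expTwoPiI_apply, Complex.norm_exp]
  simp

theorem norm_expTwoPiI_ofReal (x : ℝ) : ‖expTwoPiI x‖ = 1 := by simp [norm_expTwoPiI]

theorem norm_expTwoPiI_lt_one {z : ℂ} (hz : 0 < z.im) : ‖expTwoPiI z‖ < 1 := by
  rw [norm_expTwoPiI, Real.exp_lt_one_iff]
  have := Real.pi_pos
  nlinarith

theorem one_lt_norm_expTwoPiI {z : ℂ} (hz : z.im < 0) : 1 < ‖expTwoPiI z‖ := by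
  rw [norm_expTwoPiI, Real.one_lt_exp_iff]
  have := Real.pi_pos
  nlinarith

theorem continuous_expTwoPiI : Continuous expTwoPiI :=
  (by fun_prop : Continuous fun z : ℂ => Complex.exp (2 * Real.pi * Complex.I * z))

end Exponential

section TorsionClass

theorem exists_isTwistedContinuation_indicator {ω₁ : ℂ} (hω₁ : ω₁ ≠ 0) (τ : ℍ) {A : Type*}
    [AddCommGroup A] [Finite A] [DecidableEq A] (π : ℤ × ℤ →+ A) (a : A) :
    ∃ F, IsTwistedContinuation ω₁ τ (fun v => if π v = a then 1 else 0) F := by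
  have := Fintype.ofFinite A
  have hchar (ψ : AddChar A ℂ) : ∃ F, IsTwistedContinuation ω₁ τ (ψ.compAddMonoidHom π) F :=
    exists_isTwistedContinuation_addChar hω₁ τ fun v => AddChar.norm_apply ψ (π v)
  choose F hF using hchar
  have hsum := (IsTwistedContinuation.sum (t := Finset.univ) fun ψ _ =>
    (hF ψ).const_mul (ψ (-a))).const_mul (Fintype.card A : ℂ)⁻¹
  have hindicator (v : ℤ × ℤ) : (Fintype.card A : ℂ)⁻¹ *
      ∑ ψ : AddChar A ℂ, ψ (-a) * ψ.compAddMonoidHom π v = if π v = a then 1 else 0 := by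
    simp only [AddChar.compAddMonoidHom_apply, ← AddChar.map_add_eq_mul,
      AddChar.sum_apply_eq_ite, neg_add_eq_zero, eq_comm (a := a), mul_ite, mul_zero]
    rw [inv_mul_cancel₀ (Nat.cast_ne_zero.2 Fintype.card_ne_zero)]
  exact ⟨_, funext hindicator ▸ hsum⟩

theorem latticePoint_div (ω₁ τ : ℂ) (N : ℕ) (v : ℤ × ℤ) :
    latticePoint (ω₁ / N) τ v = latticePoint ω₁ τ v / N := by
  rw [latticePoint_apply, latticePoint_apply, div_mul_eq_mul_div]

theorem mk_mem_torsionBy_iff {N : ℕ} {ω₁ τ w : ℂ} :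
    Submodule.Quotient.mk w ∈ Submodule.torsionBy ℤ (ℂ ⧸ periodLattice ω₁ τ) (N : ℤ) ↔
      (N : ℂ) * w ∈ periodLattice ω₁ τ := by
  rw [Submodule.mem_torsionBy_iff, ← Submodule.Quotient.mk_smul, Submodule.Quotient.mk_eq_zero,
    zsmul_eq_mul, Int.cast_natCast]

variable (N : ℕ) [NeZero N] (ω₁ τ : ℂ)

/-- The class of `ω / N` modulo the lattice `L = ℤ·ω₁ + ℤ·ω₁τ`, for `ω ∈ L`, as an element of
`N⁻¹L / L`, the `N`-torsion of `ℂ / L`. -/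
def torsionClass :
    ℤ × ℤ →ₗ[ℤ] Submodule.torsionBy ℤ (ℂ ⧸ periodLattice ω₁ τ) (N : ℤ) :=
  ((periodLattice ω₁ τ).mkQ.comp (latticePoint (ω₁ / N) τ)).codRestrict _ fun v => by
    rw [Submodule.mem_torsionBy_iff, LinearMap.comp_apply, ← map_smul, ← LinearMap.mem_ker,
      Submodule.ker_mkQ, latticePoint_div, zsmul_eq_mul, Int.cast_natCast,
      mul_div_cancel₀ _ (NeZero.ne _)]
    exact latticePoint_mem_periodLattice ω₁ τ v

theorem coe_torsionClass (v : ℤ × ℤ) :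
    (torsionClass N ω₁ τ v : ℂ ⧸ periodLattice ω₁ τ) =
      Submodule.Quotient.mk (latticePoint ω₁ τ v / N) := by
  rw [← latticePoint_div]
  rfl

variable {N ω₁ τ}

theorem torsionClass_eq_iff {c : Submodule.torsionBy ℤ (ℂ ⧸ periodLattice ω₁ τ) (N : ℤ)} {w : ℂ}
    (hc : (c : ℂ ⧸ periodLattice ω₁ τ) = Submodule.Quotient.mk w) {v : ℤ × ℤ} :
    torsionClass N ω₁ τ v = c ↔ latticePoint ω₁ τ v / N - w ∈ periodLattice ω₁ τ := by
  rw [Subtype.ext_iff, coe_torsionClass, hc, Submodule.Quotient.eq]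

theorem exists_latticePoint_div_eq {w : ℂ} (hw : (N : ℂ) * w ∈ periodLattice ω₁ τ) :
    ∃ v, latticePoint ω₁ τ v / N = w := by
  obtain ⟨v, hv⟩ := mem_periodLattice.1 hw
  exact ⟨v, by rw [hv, mul_div_cancel_left₀ _ (NeZero.ne _)]⟩

theorem torsionClass_surjective : Function.Surjective (torsionClass N ω₁ τ) := by
  rintro ⟨c, hc⟩
  obtain ⟨w, rfl⟩ := Submodule.Quotient.mk_surjective _ c
  obtain ⟨v, rfl⟩ := exists_latticePoint_div_eq (mk_mem_torsionBy_iff.1 hc)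
  exact ⟨v, Subtype.ext (coe_torsionClass N ω₁ τ v)⟩

instance finite_torsionBy_periodLattice :
    Finite (Submodule.torsionBy ℤ (ℂ ⧸ periodLattice ω₁ τ) (N : ℤ)) := by
  have := Module.Finite.of_surjective _ (torsionClass_surjective (N := N) (ω₁ := ω₁) (τ := τ))
  exact Module.finite_of_fg_torsion _ fun c =>
    ⟨⟨(N : ℤ), mem_nonZeroDivisors_of_ne_zero (NeZero.ne _)⟩, Subtype.ext c.2⟩

end TorsionClass

section HeckeSeries

variable {N : ℕ} [NeZero N] {ω₁ : ℂ} (hω₁ : ω₁ ≠ 0) (τ : ℍ)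
include hω₁

open Classical in
theorem IsTwistedContinuation.isHeckeContinuation
    {c : Submodule.torsionBy ℤ (ℂ ⧸ periodLattice ω₁ τ) (N : ℤ)} {w : ℂ}
    (hc : (c : ℂ ⧸ periodLattice ω₁ τ) = Submodule.Quotient.mk w) {F : ℂ → ℂ}
    (hF : IsTwistedContinuation ω₁ τ (fun v => if torsionClass N ω₁ τ v = c then 1 else 0) F) :
    IsHeckeContinuation N (periodLattice ω₁ τ) w F := by
  have hmem : (N : ℂ) * w ∈ periodLattice ω₁ τ := mk_mem_torsionBy_iff.1 (hc ▸ c.2)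
  refine ⟨-1, by norm_num, hF.differentiableOn, fun s hs => ?_⟩
  have hrange (ω : ℂ) (hω : ω / N - w ∈ periodLattice ω₁ τ) :
      ω ∈ Set.range (latticePoint ω₁ τ) := by
    refine mem_periodLattice.1 ((Submodule.sub_mem_iff_left _ hmem).1 ?_)
    have := Submodule.smul_mem _ (N : ℤ) hω
    rwa [zsmul_eq_mul, Int.cast_natCast, mul_sub, mul_div_cancel₀ _ (NeZero.ne _)] at this
  change HasSum (heckeTerm s ∘ (Subtype.val : HeckeIndex N (periodLattice ω₁ τ) w → ℂ)) (F s)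
  rw [hasSum_subtype_iff_indicator, ← (latticePoint_injective hω₁ τ).hasSum_iff fun ω hω =>
    Set.indicator_of_notMem (fun hm => hω (hrange ω hm.2)) _]
  refine (hF.hasSum s hs).congr_fun fun v => ?_
  simp only [Function.comp, Set.indicator, HeckeIndex, Set.mem_ofPred_eq, torsionClass_eq_iff hc]
  by_cases hv : latticePoint ω₁ τ v = 0
  · simp [hv]
  · simp [hv]

theorem exists_isHeckeContinuation {w : ℂ} (hw : (N : ℂ) * w ∈ periodLattice ω₁ τ) :
    ∃ F, IsHeckeContinuation N (periodLattice ω₁ τ) w F := by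
  classical
  obtain ⟨F, hF⟩ := exists_isTwistedContinuation_indicator hω₁ τ
    (torsionClass N ω₁ τ).toAddMonoidHom ⟨_, mk_mem_torsionBy_iff.2 hw⟩
  exact ⟨F, hF.isHeckeContinuation hω₁ τ rfl⟩

theorem exists_isTwistedContinuation_torsion
    (χ : Submodule.torsionBy ℤ (ℂ ⧸ periodLattice ω₁ τ) (N : ℤ) → ℂ) :
    ∃ F, IsTwistedContinuation ω₁ τ (fun v => χ (torsionClass N ω₁ τ v)) F ∧
      F 0 = ∑ᶠ c, χ c * heckeG N (periodLattice ω₁ τ) (Quotient.out c.1) := by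
  classical
  have := Fintype.ofFinite (Submodule.torsionBy ℤ (ℂ ⧸ periodLattice ω₁ τ) (N : ℤ))
  choose G hG using exists_isTwistedContinuation_indicator hω₁ τ
    (torsionClass N ω₁ τ).toAddMonoidHom
  have hG0 (c : Submodule.torsionBy ℤ (ℂ ⧸ periodLattice ω₁ τ) (N : ℤ)) :
      heckeG N (periodLattice ω₁ τ) (Quotient.out c.1) = G c 0 :=
    ((hG c).isHeckeContinuation hω₁ τ (Quotient.out_eq' c.1).symm).heckeG_eq
  refine ⟨fun s => ∑ c, χ c * G c s, ?_, ?_⟩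
  · have hsum := IsTwistedContinuation.sum (t := Finset.univ) fun c _ => (hG c).const_mul (χ c)
    have hχ (v : ℤ × ℤ) : (∑ c, χ c * if torsionClass N ω₁ τ v = c then 1 else 0) =
        χ (torsionClass N ω₁ τ v) := by
      rw [Finset.sum_mul_boole, if_pos (Finset.mem_univ _)]
    exact funext hχ ▸ hsum
  · simp only [finsum_eq_sum_of_fintype, hG0]

theorem heckeG'_eq_of_isTwistedContinuation {u : ℂ} {F : ℂ → ℂ}
    (hu : ∀ w ∈ periodLattice ω₁ τ, ∀ v,
      latticeChar N (periodLattice ω₁ τ) u (v + w) = latticeChar N (periodLattice ω₁ τ) u v)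
    (hF : IsTwistedContinuation ω₁ τ
      (fun v => latticeChar N (periodLattice ω₁ τ) u (latticePoint ω₁ τ v / N)) F) :
    heckeG' N (periodLattice ω₁ τ) u = F 0 := by
  obtain ⟨G, hG, hG0⟩ := exists_isTwistedContinuation_torsion (N := N) hω₁ τ fun c =>
    latticeChar N (periodLattice ω₁ τ) u (Quotient.out c.1)
  have hchar (v : ℤ × ℤ) : latticeChar N (periodLattice ω₁ τ) u
      (Quotient.out (torsionClass N ω₁ τ v).1) =
        latticeChar N (periodLattice ω₁ τ) u (latticePoint ω₁ τ v / N) := by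
    have hmem := (torsionClass_eq_iff (Quotient.out_eq' (torsionClass N ω₁ τ v).1).symm).1 rfl
    rw [← hu _ hmem, add_sub_cancel]
  simp only [hchar] at hG
  exact hG0.symm.trans (hG.apply_zero_eq hF)

end HeckeSeries

section Character

theorem wedge_latticePoint (ω₁ τ : ℂ) (v w : ℤ × ℤ) :
    wedge (latticePoint ω₁ τ v) (latticePoint ω₁ τ w) =
      Complex.normSq ω₁ * τ.im * ((v.2 * w.1 - v.1 * w.2 : ℤ) : ℝ) := by
  simp only [wedge, latticePoint_apply, Complex.normSq_apply, Complex.mul_re, Complex.mul_im,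
    Complex.add_re, Complex.add_im, Complex.intCast_re, Complex.intCast_im]
  push_cast
  ring

theorem wedge_div_natCast_left (x y : ℂ) (N : ℕ) : wedge (x / N) y = wedge x y / N := by
  simp only [wedge, Complex.div_natCast_re, Complex.div_natCast_im]
  ring

theorem wedge_div_natCast_right (x y : ℂ) (N : ℕ) : wedge x (y / N) = wedge x y / N := by
  simp only [wedge, Complex.div_natCast_re, Complex.div_natCast_im]
  ring

theorem latticeChar_add (N : ℕ) (L : Submodule ℤ ℂ) (u v w : ℂ) :
    latticeChar N L u (v + w) = latticeChar N L u v * latticeChar N L u w := by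
  simp only [latticeChar, wedge, Complex.add_re, Complex.add_im, ← Complex.exp_add]
  congr 1
  push_cast
  ring

/-- The character `(d, c) ↦ exp(2πi (y d - x c))` of `ℤ × ℤ`, through which `χ^L_u` factors for
`u = ω₁ (x τ + y)`. -/
def latticeTwist (x y : ℝ) : AddChar (ℤ × ℤ) ℂ :=
  expTwoPiI.compAddMonoidHom
    ((LinearMap.toSpanSingleton ℤ ℂ y).coprod (LinearMap.toSpanSingleton ℤ ℂ (-x))).toAddMonoidHom

theorem latticeTwist_apply (x y : ℝ) (v : ℤ × ℤ) :
    latticeTwist x y v = expTwoPiI (y * v.1 - x * v.2) := by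
  simp only [latticeTwist, AddChar.compAddMonoidHom_apply, LinearMap.toAddMonoidHom_coe,
    LinearMap.coprod_apply, LinearMap.toSpanSingleton_apply, zsmul_eq_mul]
  ring_nf

theorem norm_latticeTwist (x y : ℝ) (v : ℤ × ℤ) : ‖latticeTwist x y v‖ = 1 := by
  rw [latticeTwist_apply]
  exact_mod_cast norm_expTwoPiI_ofReal (y * v.1 - x * v.2)

variable {ω₁ : ℂ} (hω₁ : ω₁ ≠ 0) (τ : ℍ)
include hω₁

theorem latticeOrientation_periodLattice :
    latticeOrientation (periodLattice ω₁ τ) = Complex.normSq ω₁ * (τ : ℂ).im := by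
  have harea : 0 < Complex.normSq ω₁ * (τ : ℂ).im :=
    mul_pos (Complex.normSq_pos.2 hω₁) τ.im_pos
  refine IsLeast.csInf_eq ⟨⟨harea, _, latticePoint_mem_periodLattice ω₁ τ (0, 1), _,
    latticePoint_mem_periodLattice ω₁ τ (1, 0), by simp [wedge_latticePoint]⟩, ?_⟩
  rintro r ⟨hr, x, hx, y, hy, rfl⟩
  obtain ⟨v, rfl⟩ := mem_periodLattice.1 hx
  obtain ⟨w, rfl⟩ := mem_periodLattice.1 hy
  rw [wedge_latticePoint] at hr ⊢
  have hdet : 0 < v.2 * w.1 - v.1 * w.2 := Int.cast_pos.1 (pos_of_mul_pos_right hr harea.le)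
  exact le_mul_of_one_le_right harea.le (by exact_mod_cast hdet)

variable (N : ℕ) [NeZero N] (p : ℤ × ℤ)

theorem latticeChar_latticePoint_div (v : ℤ × ℤ) :
    latticeChar N (periodLattice ω₁ τ) (latticePoint ω₁ τ p / N) (latticePoint ω₁ τ v / N) =
      latticeTwist (p.1 / N) (p.2 / N) v := by
  have harea : Complex.normSq ω₁ * (τ : ℂ).im ≠ 0 :=
    mul_ne_zero (Complex.normSq_pos.2 hω₁).ne' τ.im_ne_zero
  have hN : (N : ℝ) ≠ 0 := NeZero.ne _
  rw [latticeChar, wedge_div_natCast_left, wedge_div_natCast_right, wedge_latticePoint,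
    latticeOrientation_periodLattice hω₁, latticeTwist_apply, expTwoPiI_apply]
  have hexponent (A k l : ℝ) (hA : A ≠ 0) : N * (A * (p.2 * k - p.1 * l) / N / N / A) =
      p.2 / N * k - p.1 / N * l := by
    field_simp
  congr 2
  rw [Int.cast_sub, Int.cast_mul, Int.cast_mul, hexponent _ _ _ harea]
  push_cast
  ring

theorem latticeChar_add_eq {w : ℂ} (hw : w ∈ periodLattice ω₁ τ) (z : ℂ) :
    latticeChar N (periodLattice ω₁ τ) (latticePoint ω₁ τ p / N) (z + w) =
      latticeChar N (periodLattice ω₁ τ) (latticePoint ω₁ τ p / N) z := by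
  obtain ⟨q, rfl⟩ := mem_periodLattice.1 hw
  have hN : (N : ℂ) ≠ 0 := NeZero.ne _
  have hq : latticePoint ω₁ τ q = latticePoint ω₁ τ ((N : ℤ) • q) / N := by
    rw [map_smul, zsmul_eq_mul, Int.cast_natCast, mul_div_cancel_left₀ _ hN]
  have hone : latticeTwist (p.1 / N) (p.2 / N) ((N : ℤ) • q) = 1 := by
    rw [latticeTwist_apply, expTwoPiI_eq_one_iff]
    refine ⟨p.2 * q.1 - p.1 * q.2, ?_⟩
    simp only [Prod.smul_fst, Prod.smul_snd, smul_eq_mul]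
    push_cast
    field_simp
  rw [latticeChar_add, hq, latticeChar_latticePoint_div hω₁, hone, mul_one]

theorem heckeG'_latticePoint_div {F : ℂ → ℂ}
    (hF : IsTwistedContinuation ω₁ τ (latticeTwist (p.1 / N) (p.2 / N)) F) :
    heckeG' N (periodLattice ω₁ τ) (latticePoint ω₁ τ p / N) = F 0 := by
  refine heckeG'_eq_of_isTwistedContinuation hω₁ τ
    (fun w hw z => latticeChar_add_eq hω₁ τ N p hw z) ?_
  simpa only [latticeChar_latticePoint_div hω₁] using hF

end Character

section Fourier

theorem fourier_coe_one_apply (c : ℤ) (x : ℝ) :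
    (fourier c (x : AddCircle (1 : ℝ)) : ℂ) = expTwoPiI (c * x) := by
  rw [fourier_coe_apply, expTwoPiI_apply]
  push_cast
  ring_nf

theorem fourierCoeffOn_zero_lt_one_neg (g : ℝ → ℂ) (c : ℤ) :
    fourierCoeffOn zero_lt_one g (-c) = ∫ x in (0 : ℝ)..1, expTwoPiI (c * x) * g x := by
  rw [fourierCoeffOn_eq_integral]
  simp only [fourier_coe_apply, expTwoPiI_apply, neg_neg, sub_zero, Complex.ofReal_one, div_one,
    one_smul, smul_eq_mul, mul_assoc]

variable {g : ℝ → ℂ} (hg : Continuous g)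
include hg

theorem fourierCoeffOn_expTwoPiI_sub_one_pow_mul (k : ℕ) (c : ℤ) :
    fourierCoeffOn zero_lt_one (fun x : ℝ => (expTwoPiI x - 1) ^ k * g x) (-c) =
      (fwdDiff 1)^[k] (fun c : ℤ => fourierCoeffOn zero_lt_one g (-c)) c := by
  induction k generalizing g with
  | zero => simp
  | succ k ih =>
    have hstep : fwdDiff 1 (fun c : ℤ => fourierCoeffOn zero_lt_one g (-c)) =
        fun c => fourierCoeffOn zero_lt_one (fun x : ℝ => (expTwoPiI x - 1) * g x) (-c) := by
      funext c
      have hint (c : ℤ) : IntervalIntegrable (fun x : ℝ => expTwoPiI (c * x) * g x)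
          MeasureTheory.volume 0 1 :=
        ((continuous_expTwoPiI.comp (by fun_prop)).mul hg).intervalIntegrable _ _
      simp only [fwdDiff, fourierCoeffOn_zero_lt_one_neg]
      rw [← intervalIntegral.integral_sub (hint _) (hint _)]
      refine intervalIntegral.integral_congr fun x _ => ?_
      simp only [Int.cast_add, Int.cast_one, add_mul, one_mul, AddChar.map_add_eq_mul]
      ring
    have hcont : Continuous fun x : ℝ => (expTwoPiI x - 1) * g x :=
      ((continuous_expTwoPiI.comp Complex.continuous_ofReal).sub continuous_const).mul hg
    simp only [pow_succ, mul_assoc, Function.iterate_succ_apply, hstep, ih hcont]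

/-- Multiplication by `exp(2πix) - 1` takes the differences of the Fourier coefficients, and its
zeros make the periodic extension of `g` from `[0, 1)` continuous. -/
theorem hasSum_fwdDiff_iter_fourierCoeffOn {k : ℕ} (hk : k ≠ 0)
    (hs : Summable ((fwdDiff 1)^[k] fun c : ℤ => fourierCoeffOn zero_lt_one g (-c)))
    {x : ℝ} (hx : x ∈ Set.Ico (0 : ℝ) 1) :
    HasSum (fun c : ℤ => expTwoPiI (-(x * c)) *
        (fwdDiff 1)^[k] (fun c : ℤ => fourierCoeffOn zero_lt_one g (-c)) c)
      ((expTwoPiI x - 1) ^ k * g x) := by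
  set H : ℝ → ℂ := fun x => (expTwoPiI x - 1) ^ k * g x with hH
  have hcont : Continuous H :=
    (((continuous_expTwoPiI.comp Complex.continuous_ofReal).sub continuous_const).pow k).mul hg
  have hends : H 0 = H (0 + 1) := by
    have hone := expTwoPiI_intCast 1
    rw [Int.cast_one] at hone
    simp [hH, hone, hk]
  let f : C(AddCircle (1 : ℝ), ℂ) :=
    ⟨AddCircle.liftIco 1 0 H, AddCircle.liftIco_continuous hends hcont.continuousOn⟩
  have hcoeff (c : ℤ) : fourierCoeff f c = fourierCoeffOn zero_lt_one H c := by
    change fourierCoeff (AddCircle.liftIco 1 0 H) c = _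
    rw [fourierCoeff_liftIco_eq]
    congr 1
    simp
  have hsummable : Summable (fourierCoeff f) := by
    rw [← (Equiv.neg ℤ).summable_iff]
    exact hs.congr fun c =>
      ((hcoeff (-c)).trans (fourierCoeffOn_expTwoPiI_sub_one_pow_mul hg k c)).symm
  have hseries := has_pointwise_sum_fourier_series_of_summable hsummable (x : AddCircle (1 : ℝ))
  rw [← (Equiv.neg ℤ).hasSum_iff] at hseries
  have hfx : f (x : AddCircle (1 : ℝ)) = H x :=
    AddCircle.liftIco_coe_apply (p := (1 : ℝ)) (a := 0) (f := H) (by rwa [zero_add])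
  rw [hfx] at hseries
  refine hseries.congr_fun fun c => ?_
  rw [Function.comp_apply, Equiv.neg_apply, hcoeff, fourier_coe_one_apply, smul_eq_mul,
    fourierCoeffOn_expTwoPiI_sub_one_pow_mul hg, mul_comm]
  push_cast
  ring_nf

end Fourier

section Lerch

/-- The value of `∑ exp(-2πixc) / (z + c)` over `c ∈ ℤ`, summed in the sense of Hecke, for
`0 < x < 1`; the term `c = 0` is omitted if `z = 0`. -/
def lerchValue (z : ℂ) (x : ℝ) : ℂ :=
  if z = 0 then 2 * Real.pi * Complex.I * (x - 1 / 2)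
  else 2 * Real.pi * Complex.I * (expTwoPiI (x * z) / (expTwoPiI z - 1))

theorem continuous_lerchValue (z : ℂ) : Continuous (lerchValue z) := by
  unfold lerchValue
  split_ifs
  · fun_prop
  · exact continuous_const.mul ((continuous_expTwoPiI.comp (by fun_prop)).div_const _)

theorem fourierCoeffOn_lerchValue_zero (c : ℤ) :
    fourierCoeffOn zero_lt_one (lerchValue 0) (-c) = (c : ℂ)⁻¹ := by
  have hbernoulli : lerchValue 0 =
      (2 * Real.pi * Complex.I : ℂ) • ((↑) ∘ bernoulliFun 1 : ℝ → ℂ) := by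
    funext x
    simp [lerchValue, bernoulliFun_one]
  rw [hbernoulli, fourierCoeffOn.const_smul]
  change _ • bernoulliFourierCoeff 1 (-c) = _
  rcases eq_or_ne c 0 with rfl | hc
  · simp [bernoulliFourierCoeff_zero]
  · have hc' : (c : ℂ) ≠ 0 := Int.cast_ne_zero.2 hc
    rw [bernoulliFourierCoeff_eq one_ne_zero]
    simp only [Nat.factorial_one, Nat.cast_one, pow_one, Int.cast_neg, smul_eq_mul]
    field_simp

theorem integral_expTwoPiI_mul {w : ℂ} (hw : w ≠ 0) :
    ∫ x in (0 : ℝ)..1, expTwoPiI (w * x) = (expTwoPiI w - 1) / (2 * Real.pi * Complex.I * w) := by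
  simp only [expTwoPiI_apply, ← mul_assoc]
  rw [integral_exp_mul_complex (mul_ne_zero Complex.two_pi_I_ne_zero hw)]
  simp

theorem fourierCoeffOn_lerchValue {z : ℂ} (hz : ∀ n : ℤ, n ≠ 0 → z ≠ n) (c : ℤ) :
    fourierCoeffOn zero_lt_one (lerchValue z) (-c) = (z + c)⁻¹ := by
  rcases eq_or_ne z 0 with rfl | hz0
  · rw [fourierCoeffOn_lerchValue_zero, zero_add]
  have hzint (n : ℤ) : z ≠ n := by
    rcases eq_or_ne n 0 with rfl | hn
    · simpa using hz0
    · exact hz n hn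
  have hne : expTwoPiI z - 1 ≠ 0 :=
    sub_ne_zero.2 fun h => (expTwoPiI_eq_one_iff.1 h).elim hzint
  have hzc : z + c ≠ 0 := fun h =>
    hzint (-c) (by rw [Int.cast_neg]; exact eq_neg_of_add_eq_zero_left h)
  have hintegrand (x : ℝ) : expTwoPiI (c * x) * lerchValue z x =
      2 * Real.pi * Complex.I / (expTwoPiI z - 1) * expTwoPiI ((z + c) * x) := by
    rw [lerchValue, if_neg hz0, add_mul, AddChar.map_add_eq_mul, mul_comm (x : ℂ) z]
    ring
  simp only [fourierCoeffOn_zero_lt_one_neg, hintegrand, intervalIntegral.integral_const_mul]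
  rw [integral_expTwoPiI_mul hzc, AddChar.map_add_eq_mul, expTwoPiI_intCast, mul_one]
  field_simp

theorem hasSum_lerchValue {z : ℂ} (hz : ∀ n : ℤ, n ≠ 0 → z ≠ n) {k : ℕ} (hk : k ≠ 0)
    (hs : Summable ((fwdDiff 1)^[k] fun c : ℤ => (z + c)⁻¹)) {x : ℝ}
    (hx : x ∈ Set.Ico (0 : ℝ) 1) :
    HasSum (fun c : ℤ => expTwoPiI (-(x * c)) * (fwdDiff 1)^[k] (fun c : ℤ => (z + c)⁻¹) c)
      ((expTwoPiI x - 1) ^ k * lerchValue z x) := by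
  simp only [← fourierCoeffOn_lerchValue hz] at hs ⊢
  exact hasSum_fwdDiff_iter_fourierCoeffOn (continuous_lerchValue z) hk hs hx

end Lerch

section InnerSum

theorem fwdDiff_iter_heckeTerm_zero_latticePoint (ω₁ τ : ℂ) (n : ℕ) (d c : ℤ) :
    (fwdDiff (latticePoint ω₁ τ (0, 1)))^[n] (heckeTerm 0) (latticePoint ω₁ τ (d, c)) =
      ω₁⁻¹ * (fwdDiff 1)^[n] (fun c : ℤ => (d * τ + c : ℂ)⁻¹) c := by
  have hcolumn := fwdDiff_iter_comp_of_map_add (P := fun c : ℤ => latticePoint ω₁ τ (d, c))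
    (h := 1) (h' := latticePoint ω₁ τ (0, 1))
    (fun c => by rw [← map_add, Prod.mk_add_mk, add_zero]) (heckeTerm 0) n
  have hinv : heckeTerm 0 ∘ (fun c : ℤ => latticePoint ω₁ τ (d, c)) =
      ω₁⁻¹ • fun c : ℤ => (d * τ + c : ℂ)⁻¹ := by
    funext c
    simp only [Function.comp_apply, heckeTerm_zero_left, latticePoint_apply, mul_inv,
      Pi.smul_apply, smul_eq_mul]
  rw [hinv, fwdDiff_iter_const_smul] at hcolumn
  exact (congrFun hcolumn c).symm

theorem latticeTwist_fract (x y : ℝ) : latticeTwist (Int.fract x) y = latticeTwist x y := by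
  ext v
  have hsplit : (y * v.1 - Int.fract x * v.2 : ℂ) =
      (y * v.1 - x * v.2) + ((⌊x⌋ * v.2 : ℤ) : ℂ) := by
    have hfract : ((Int.fract x : ℝ) : ℂ) = x - ⌊x⌋ := by
      rw [← Int.self_sub_floor, Complex.ofReal_sub, Complex.ofReal_intCast]
    rw [hfract]
    push_cast
    ring
  rw [latticeTwist_apply, latticeTwist_apply, hsplit, AddChar.map_add_eq_mul, expTwoPiI_intCast,
    mul_one]

theorem coe_mul_ne_intCast (τ : ℍ) (d n : ℤ) (hn : n ≠ 0) : (d * τ : ℂ) ≠ n := by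
  intro h
  have him := congrArg Complex.im h
  rcases eq_or_ne d 0 with rfl | hd
  · exact hn (by simpa [eq_comm] using h)
  · simp [hd, τ.im_ne_zero] at him

theorem summable_fwdDiff_iter_two_inv (τ : ℍ) (d : ℤ) :
    Summable ((fwdDiff 1)^[2] fun c : ℤ => (d * τ + c : ℂ)⁻¹) := by
  have hpairs := summable_addChar_mul_fwdDiff_iter_two_heckeTerm one_ne_zero τ (ψ := 1)
    (fun v => by simp) (latticePoint 1 τ (0, 1)) (s := 0) (by simp)
  refine (hpairs.prod_factor d).congr fun c => ?_
  rw [fwdDiff_iter_heckeTerm_zero_latticePoint, AddChar.one_apply, inv_one, one_mul, one_mul]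

theorem expTwoPiI_ne_one_of_mem_Ioo {x : ℝ} (hx : x ∈ Set.Ioo (0 : ℝ) 1) : expTwoPiI x ≠ 1 := by
  intro h
  obtain ⟨n, hn⟩ := expTwoPiI_eq_one_iff.1 h
  have hxn : x = n := by exact_mod_cast hn
  rw [hxn, Set.mem_Ioo] at hx
  have h0 : 0 < n := by exact_mod_cast hx.1
  have h1 : n < 1 := by exact_mod_cast hx.2
  omega

theorem IsTwistedContinuation.hasSum_lerchValue {ω₁ : ℂ} (hω₁ : ω₁ ≠ 0) (τ : ℍ) {x : ℝ}
    (hx : x ∈ Set.Ioo (0 : ℝ) 1) (y : ℝ) {F : ℂ → ℂ}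
    (hF : IsTwistedContinuation ω₁ τ (latticeTwist x y) F) :
    HasSum (fun d : ℤ => expTwoPiI (y * d) * lerchValue (d * τ) x) (ω₁ * F 0) := by
  have hneg : latticeTwist x y (-(0, 1)) = expTwoPiI x := by simp [latticeTwist_apply]
  have hpos : latticeTwist x y (0, 1) = (expTwoPiI x)⁻¹ := by
    rw [← hneg, AddChar.map_neg_eq_inv, inv_inv]
  have hne : expTwoPiI x - 1 ≠ 0 := sub_ne_zero.2 (expTwoPiI_ne_one_of_mem_Ioo hx)
  have hF0 := hF.apply_zero_eq <| isTwistedContinuation_addChar hω₁ τ (norm_latticeTwist x y)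
    (v₀ := (0, 1)) (by rw [hpos]; exact inv_ne_one.2 (expTwoPiI_ne_one_of_mem_Ioo hx))
  have hpairs := (summable_addChar_mul_fwdDiff_iter_two_heckeTerm hω₁ τ (norm_latticeTwist x y)
    (latticePoint ω₁ τ (0, 1)) (s := 0) (by simp)).hasSum
  have hcolumn (d : ℤ) := (HeckeEisenstein.hasSum_lerchValue (coe_mul_ne_intCast τ d) two_ne_zero
    (summable_fwdDiff_iter_two_inv τ d) ⟨hx.1.le, hx.2⟩).mul_left (expTwoPiI (y * d) * ω₁⁻¹)
  have hfiberwise := hpairs.prod_fiberwise fun d => (hcolumn d).congr_fun fun c => by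
    rw [fwdDiff_iter_heckeTerm_zero_latticePoint, latticeTwist_apply, sub_eq_add_neg,
      AddChar.map_add_eq_mul, mul_mul_mul_comm]
  rw [hF0, hneg, ← mul_assoc]
  refine (hfiberwise.mul_left _).congr_fun fun d => ?_
  field_simp

theorem hasSum_lerchValue_heckeG' {ω₁ : ℂ} (hω₁ : ω₁ ≠ 0) (τ : ℍ) (N : ℕ) [NeZero N]
    {p : ℤ × ℤ} (hp : ¬ (N : ℤ) ∣ p.1) :
    HasSum (fun d : ℤ => expTwoPiI ((p.2 / N : ℝ) * d) *
        lerchValue (d * τ) (Int.fract ((p.1 : ℝ) / N)))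
      (ω₁ * heckeG' N (periodLattice ω₁ τ) (latticePoint ω₁ τ p / N)) := by
  obtain ⟨F, hF⟩ := exists_isTwistedContinuation_addChar hω₁ τ
    (norm_latticeTwist ((p.1 : ℝ) / N) ((p.2 : ℝ) / N))
  have hfract : 0 < Int.fract ((p.1 : ℝ) / N) := by
    refine (Int.fract_nonneg _).lt_of_ne fun h => hp ?_
    obtain ⟨n, hn⟩ := Int.fract_eq_zero_iff.1 h.symm
    rw [eq_div_iff (NeZero.ne _)] at hn
    exact ⟨n, by rw [mul_comm]; exact_mod_cast hn.symm⟩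
  rw [heckeG'_latticePoint_div hω₁ τ N p hF]
  rw [← latticeTwist_fract] at hF
  exact hF.hasSum_lerchValue hω₁ τ ⟨hfract, Int.fract_lt_one _⟩

end InnerSum

section Lambert

theorem hasSum_ite_nonneg_zpow {X : ℂ} (hX : ‖X‖ < 1) :
    HasSum (fun j : ℤ => if 0 ≤ j then X ^ j else 0) (1 - X)⁻¹ := by
  have hnonneg := hasSum_geometric_of_norm_lt_one hX
  have hneg : HasSum (fun _ : ℕ => (0 : ℂ)) 0 := hasSum_zero
  simpa using HasSum.of_nat_of_neg_add_one (f := fun j : ℤ => if 0 ≤ j then X ^ j else 0)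
    (hnonneg.congr_fun fun n => by simp) (hneg.congr_fun fun n => if_neg (by omega))

theorem hasSum_ite_neg_zpow {X : ℂ} (hX : 1 < ‖X‖) :
    HasSum (fun j : ℤ => if 0 ≤ j then 0 else X ^ j) (-(1 - X)⁻¹) := by
  have hX0 : X ≠ 0 := norm_pos_iff.1 (one_pos.trans hX)
  have hnorm : ‖X⁻¹‖ < 1 := by rw [norm_inv]; exact inv_lt_one_of_one_lt₀ hX
  have hnonneg : HasSum (fun _ : ℕ => (0 : ℂ)) 0 := hasSum_zero
  have hneg := (hasSum_geometric_of_norm_lt_one hnorm).mul_left X⁻¹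
  have hvalue : X⁻¹ * (1 - X⁻¹)⁻¹ = -(1 - X)⁻¹ := by
    rw [← mul_inv, mul_sub, mul_one, mul_inv_cancel₀ hX0, ← inv_neg, neg_sub]
  rw [← zero_add (-(1 - X)⁻¹), ← hvalue]
  refine HasSum.of_nat_of_neg_add_one (f := fun j : ℤ => if 0 ≤ j then 0 else X ^ j)
    (hnonneg.congr_fun fun n => if_pos (by omega)) (hneg.congr_fun fun n => ?_)
  rw [if_neg (by omega), zpow_neg, ← inv_zpow, ← Nat.cast_succ, zpow_natCast, pow_succ']

theorem hasSum_ite_modEq_iff {N : ℤ} (hN : N ≠ 0) (ℓ : ℤ) {f : ℤ → ℂ} {S : ℂ} :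
    HasSum (fun m => if m ≡ ℓ [ZMOD N] then f m else 0) S ↔
      HasSum (fun j => f (ℓ % N + N * j)) S := by
  have hinj : Function.Injective fun j => ℓ % N + N * j :=
    (add_right_injective _).comp (mul_right_injective₀ hN)
  have hcomp : (fun m => if m ≡ ℓ [ZMOD N] then f m else 0) ∘ (fun j => ℓ % N + N * j) =
      fun j => f (ℓ % N + N * j) :=
    funext fun j => if_pos ((Int.add_mul_emod_self_left ..).trans (Int.mod_modEq ..))
  rw [← hcomp, hinj.hasSum_iff]
  refine fun m hm => if_neg fun h => hm ⟨m / N, ?_⟩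
  rw [← h.eq]
  exact Int.emod_add_mul_ediv m N

theorem sign_emod_add_mul {N ℓ : ℤ} (hN : 0 < N) (hℓ : ¬ N ∣ ℓ) (j : ℤ) :
    (ℓ % N + N * j).sign = if 0 ≤ j then 1 else -1 := by
  have hpos := Int.emod_pos_of_not_dvd hℓ
  have hlt := Int.emod_lt_of_pos ℓ hN
  split_ifs with hj
  · exact Int.sign_eq_one_of_pos (by have := mul_nonneg hN.le hj; omega)
  · exact Int.sign_eq_neg_one_of_neg (by nlinarith)

/-- The terms `exp(2πi y d) sgn(m) q^(dm/N)`, where `d` and `m` have the same sign and `m ≡ ℓ`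
modulo `N`, of the double series that `G'` turns into. -/
def lambertTerm (N : ℕ) (ℓ : ℤ) (y : ℝ) (τ : ℂ) (v : ℤ × ℤ) : ℂ :=
  if v.2 ≡ ℓ [ZMOD N] then
    if 0 < v.1 * v.2 then expTwoPiI (y * v.1) * v.2.sign * expTwoPiI (τ / N * (v.1 * v.2 : ℤ))
    else 0
  else 0

theorem expTwoPiI_div_mul_emod_add (N : ℕ) [NeZero N] (ℓ : ℤ) (τ : ℂ) (d j : ℤ) :
    expTwoPiI (τ / N * ((d * (ℓ % N + N * j) : ℤ) : ℂ)) =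
      expTwoPiI (Int.fract ((ℓ : ℝ) / N) * (d * τ)) * expTwoPiI (d * τ) ^ j := by
  have hN : (N : ℂ) ≠ 0 := NeZero.ne _
  have hfract : Int.fract ((ℓ : ℝ) / N) = (ℓ % N : ℤ) / N := by
    exact_mod_cast Int.fract_div_intCast_eq_div_intCast_mod (k := ℝ) (m := ℓ) (n := N)
  rw [← AddChar.map_zsmul_eq_zpow, ← AddChar.map_add_eq_mul, hfract, zsmul_eq_mul]
  congr 1
  push_cast
  field_simp

theorem hasSum_lambertTerm {N : ℕ} [NeZero N] {ℓ : ℤ} (hℓ : ¬ (N : ℤ) ∣ ℓ) (y : ℝ) (τ : ℍ)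
    {d : ℤ} (hd : d ≠ 0) :
    HasSum (fun m => lambertTerm N ℓ y τ (d, m))
      (expTwoPiI (y * d) * (expTwoPiI (Int.fract ((ℓ : ℝ) / N) * (d * τ)) /
        (1 - expTwoPiI (d * τ)))) := by
  have hN : (0 : ℤ) < N := by exact_mod_cast Nat.pos_of_neZero N
  have him : (d * τ : ℂ).im = d * τ.im := by simp
  refine (hasSum_ite_modEq_iff hN.ne' ℓ).2 ?_
  simp only [expTwoPiI_div_mul_emod_add, ← Int.sign_eq_one_iff_pos, Int.sign_mul,
    sign_emod_add_mul hN hℓ]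
  rcases hd.lt_or_gt with hd | hd
  · have hX : 1 < ‖expTwoPiI (d * τ)‖ := one_lt_norm_expTwoPiI <| by
      rw [him]; exact mul_neg_of_neg_of_pos (by exact_mod_cast hd) τ.im_pos
    have h := (hasSum_ite_neg_zpow hX).mul_left (-(expTwoPiI (y * d) *
      expTwoPiI (Int.fract ((ℓ : ℝ) / N) * (d * τ))))
    rw [neg_mul_neg, mul_assoc, ← div_eq_mul_inv] at h
    refine h.congr_fun fun j => ?_
    rw [Int.sign_eq_neg_one_of_neg hd]
    by_cases hj : 0 ≤ j
    · simp [hj]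
    · simp [hj, mul_assoc]
  · have hX : ‖expTwoPiI (d * τ)‖ < 1 := norm_expTwoPiI_lt_one <| by
      rw [him]; exact mul_pos (by exact_mod_cast hd) τ.im_pos
    have h := (hasSum_ite_nonneg_zpow hX).mul_left (expTwoPiI (y * d) *
      expTwoPiI (Int.fract ((ℓ : ℝ) / N) * (d * τ)))
    rw [mul_assoc, ← div_eq_mul_inv] at h
    refine h.congr_fun fun j => ?_
    rw [Int.sign_eq_one_of_pos hd]
    by_cases hj : 0 ≤ j <;> simp [hj, mul_assoc]

end Lambert

section DivisorPairs

variable {N : ℕ} {ℓ : ℤ}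

theorem mem_divisorsCongr {n : ℕ} (hn : n ≠ 0) {m : ℤ} :
    m ∈ divisorsCongr N ℓ n ↔ m ∣ (n : ℤ) ∧ m ≡ ℓ [ZMOD N] := by
  rw [divisorsCongr, Finset.mem_filter, and_iff_right_iff_imp, Finset.mem_Icc, ← abs_le]
  exact fun h => Int.le_of_dvd (by omega) ((abs_dvd _ _).2 h.1)

theorem card_divisorsCongr_le (N : ℕ) (ℓ : ℤ) (n : ℕ) :
    (divisorsCongr N ℓ n).card ≤ 2 * n + 1 := by
  refine (Finset.card_filter_le _ _).trans ?_
  rw [Int.card_Icc]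
  omega

theorem summable_sigma_divisorsCongr_pow (N : ℕ) (ℓ : ℤ) {r : ℝ} (hr0 : 0 ≤ r) (hr1 : r < 1) :
    Summable fun p : Σ n : ℕ+, divisorsCongr N ℓ n => r ^ (p.1 : ℕ) := by
  have hr : ‖r‖ < 1 := by rwa [Real.norm_of_nonneg hr0]
  refine (summable_sigma_of_nonneg fun p => by positivity).2
    ⟨fun n => (hasSum_fintype _).summable, ?_⟩
  have hbound := (((summable_pow_mul_geometric_of_norm_lt_one 1 hr).mul_left 2).add
    (summable_geometric_of_norm_lt_one hr)).comp_injective PNat.coe_injective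
  refine Summable.of_nonneg_of_le (fun n => tsum_nonneg fun m => by positivity) (fun n => ?_) hbound
  have hcard : ((divisorsCongr N ℓ n).card : ℝ) ≤ 2 * n + 1 := by
    exact_mod_cast card_divisorsCongr_le N ℓ n
  simp only [tsum_fintype, Function.comp_apply]
  rw [Finset.sum_const, Finset.card_univ, Fintype.card_coe, nsmul_eq_mul]
  refine (mul_le_mul_of_nonneg_right hcard (by positivity)).trans_eq ?_
  ring

/-- The factorization `n = (n / m) * m` attached to a divisor `m ≡ ℓ` of `n`. -/
def divisorPair (p : Σ n : ℕ+, divisorsCongr N ℓ n) : ℤ × ℤ := ((p.1 : ℕ) / (p.2 : ℤ), p.2)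

theorem divisorPair_fst_mul_snd (p : Σ n : ℕ+, divisorsCongr N ℓ n) :
    (divisorPair p).1 * (divisorPair p).2 = (p.1 : ℕ) :=
  Int.ediv_mul_cancel ((mem_divisorsCongr p.1.ne_zero).1 p.2.2).1

theorem divisorPair_injective : Function.Injective (divisorPair (N := N) (ℓ := ℓ)) := by
  intro p p' h
  have hn : p.1 = p'.1 := by
    have hprod := divisorPair_fst_mul_snd p
    rw [h, divisorPair_fst_mul_snd] at hprod
    exact PNat.coe_injective (by exact_mod_cast hprod.symm)
  obtain ⟨n, m⟩ := p
  obtain ⟨n', m'⟩ := p'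
  obtain rfl : n = n' := hn
  exact congrArg (Sigma.mk n) (Subtype.ext (congrArg Prod.snd h))

theorem lambertTerm_divisorPair (y : ℝ) (τ : ℂ) (p : Σ n : ℕ+, divisorsCongr N ℓ n) :
    lambertTerm N ℓ y τ (divisorPair p) =
      expTwoPiI (y * (((p.1 : ℕ) / (p.2 : ℤ) : ℤ) : ℂ)) * (p.2 : ℤ).sign *
        expTwoPiI (τ / N) ^ (p.1 : ℕ) := by
  have hcongr : (divisorPair p).2 ≡ ℓ [ZMOD N] := ((mem_divisorsCongr p.1.ne_zero).1 p.2.2).2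
  rw [lambertTerm, if_pos hcongr, divisorPair_fst_mul_snd,
    if_pos (Int.natCast_pos.2 p.1.pos), ← AddChar.map_nsmul_eq_pow, nsmul_eq_mul,
    mul_comm (τ / N : ℂ), Int.cast_natCast]
  rfl

theorem lambertTerm_of_notMem_range_divisorPair (y : ℝ) (τ : ℂ) {v : ℤ × ℤ}
    (hv : v ∉ Set.range (divisorPair (N := N) (ℓ := ℓ))) : lambertTerm N ℓ y τ v = 0 := by
  by_contra h
  simp only [lambertTerm, ite_eq_right_iff, Classical.not_imp] at h
  obtain ⟨hcongr, hpos, -⟩ := h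
  obtain ⟨n, hn⟩ := Int.eq_ofNat_of_zero_le hpos.le
  have hn0 : 0 < n := by omega
  have hm : v.2 ∈ divisorsCongr N ℓ n :=
    (mem_divisorsCongr hn0.ne').2 ⟨⟨v.1, by rw [mul_comm]; exact hn.symm⟩, hcongr⟩
  refine hv ⟨⟨⟨n, hn0⟩, v.2, hm⟩, Prod.ext ?_ rfl⟩
  exact Int.ediv_eq_of_eq_mul_left (right_ne_zero_of_mul hpos.ne') hn.symm

theorem summable_lambertTerm_divisorPair [NeZero N] (y : ℝ) (τ : ℍ) :
    Summable fun p : Σ n : ℕ+, divisorsCongr N ℓ n => lambertTerm N ℓ y τ (divisorPair p) := by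
  have hq : ‖expTwoPiI (τ / N)‖ < 1 := norm_expTwoPiI_lt_one <| by
    rw [Complex.div_natCast_im]
    exact div_pos τ.im_pos (by exact_mod_cast Nat.pos_of_neZero N)
  refine .of_norm_bounded (summable_sigma_divisorsCongr_pow N ℓ (norm_nonneg _) hq) fun p => ?_
  have hchar : ‖expTwoPiI (y * (((p.1 : ℕ) / (p.2 : ℤ) : ℤ) : ℂ))‖ = 1 := by
    exact_mod_cast norm_expTwoPiI_ofReal (y * ((p.1 : ℕ) / (p.2 : ℤ) : ℤ))
  have hsign : ‖((p.2 : ℤ).sign : ℂ)‖ ≤ 1 := by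
    rcases Int.sign_trichotomy (p.2 : ℤ) with h | h | h <;> simp [h]
  rw [lambertTerm_divisorPair, norm_mul, norm_mul, norm_pow, hchar, one_mul]
  exact mul_le_of_le_one_left (by positivity) hsign

theorem exists_hasSum_lambertTerm (N : ℕ) [NeZero N] (ℓ : ℤ) (y : ℝ) (τ : ℍ) :
    ∃ T, HasSum (lambertTerm N ℓ y τ) T ∧
      HasSum (fun n : ℕ+ => (∑ m ∈ divisorsCongr N ℓ n,
        expTwoPiI (y * (((n : ℕ) / m : ℤ) : ℂ)) * m.sign) * expTwoPiI (τ / N) ^ (n : ℕ)) T := by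
  obtain ⟨T, hT⟩ := summable_lambertTerm_divisorPair (N := N) (ℓ := ℓ) y τ
  refine ⟨T, (divisorPair_injective.hasSum_iff fun v =>
    lambertTerm_of_notMem_range_divisorPair y τ).1 hT, ?_⟩
  refine (hT.sigma fun n => hasSum_fintype _).congr_fun fun n => ?_
  simp only [lambertTerm_divisorPair]
  rw [← Finset.sum_mul, ← Finset.sum_coe_sort]

end DivisorPairs

section QExpansion

variable {N : ℕ} [NeZero N] {ω₁ : ℂ} (hω₁ : ω₁ ≠ 0) (τ : ℍ) {ℓ : ℤ} (hℓ : ¬ (N : ℤ) ∣ ℓ)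

include hℓ in
theorem hasSum_lambertTerm_lerchValue (y : ℝ) (d : ℤ) :
    HasSum (fun m => lambertTerm N ℓ y τ (d, m))
      ((if d = 0 then (Int.fract ((ℓ : ℝ) / N) - 1 / 2 : ℂ) else 0) -
        (2 * Real.pi * Complex.I)⁻¹ *
          (expTwoPiI (y * d) * lerchValue (d * τ) (Int.fract ((ℓ : ℝ) / N)))) := by
  have hpi := Complex.two_pi_I_ne_zero
  rcases eq_or_ne d 0 with rfl | hd
  · have hzero (m : ℤ) : lambertTerm N ℓ y τ (0, m) = 0 := by simp [lambertTerm]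
    simp only [hzero, lerchValue, Int.cast_zero, zero_mul, mul_zero, if_true,
      AddChar.map_zero_eq_one, one_mul, inv_mul_cancel_left₀ hpi, sub_self]
    exact hasSum_zero
  · have hz : (d * τ : ℂ) ≠ 0 := mul_ne_zero (by exact_mod_cast hd) τ.ne_zero
    rw [if_neg hd, lerchValue, if_neg hz, mul_left_comm, inv_mul_cancel_left₀ hpi, zero_sub,
      ← mul_neg, ← div_neg, neg_sub]
    exact hasSum_lambertTerm hℓ y τ hd

include hω₁ hℓ in
theorem hasSum_qExpansion (k : ℤ) :
    HasSum (fun n : ℕ+ => (∑ m ∈ divisorsCongr N ℓ n,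
        expTwoPiI ((k / N : ℝ) * (((n : ℕ) / m : ℤ) : ℂ)) * m.sign) *
          Complex.exp (2 * Real.pi * Complex.I * τ * (n : ℕ) / N))
      (((Int.fract ((ℓ : ℚ) / N) - 1 / 2 : ℚ) : ℂ) - ω₁ / (2 * Real.pi * Complex.I) *
        heckeG' N (periodLattice ω₁ τ) (latticePoint ω₁ τ (ℓ, k) / N)) := by
  obtain ⟨T, hpairs, hdivisors⟩ := exists_hasSum_lambertTerm N ℓ ((k : ℝ) / N) τ
  have hcolumns := hpairs.prod_fiberwise (hasSum_lambertTerm_lerchValue τ hℓ _)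
  have hconst := hasSum_ite_eq (0 : ℤ) (Int.fract ((ℓ : ℝ) / N) - 1 / 2 : ℂ)
  have hseries := (hasSum_lerchValue_heckeG' hω₁ τ N (p := (ℓ, k)) hℓ).mul_left
    (2 * Real.pi * Complex.I)⁻¹
  have hT := hcolumns.unique (hconst.sub hseries)
  have hfract : ((Int.fract ((ℓ : ℚ) / N) : ℚ) : ℂ) = (Int.fract ((ℓ : ℝ) / N) : ℝ) := by
    rw [← Complex.ofReal_ratCast, Rat.cast_fract, Rat.cast_div, Rat.cast_intCast,
      Rat.cast_natCast]
  have hvalue : (((Int.fract ((ℓ : ℚ) / N) - 1 / 2 : ℚ) : ℂ) -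
      ω₁ / (2 * Real.pi * Complex.I) *
        heckeG' N (periodLattice ω₁ τ) (latticePoint ω₁ τ (ℓ, k) / N)) = T := by
    rw [hT, Rat.cast_sub, hfract, div_eq_inv_mul ω₁, mul_assoc, Rat.cast_div,
      Rat.cast_one, Rat.cast_ofNat]
  rw [hvalue]
  refine hdivisors.congr_fun fun n => ?_
  rw [← AddChar.map_nsmul_eq_pow, expTwoPiI_apply (_ • _), nsmul_eq_mul]
  congr 2
  ring

include hω₁ hℓ in
theorem hasSum_sum_sign_divisorsCongr :
    HasSum (fun n : ℕ+ => ((∑ m ∈ divisorsCongr N ℓ n, m.sign : ℤ) : ℂ) *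
        Complex.exp (2 * Real.pi * Complex.I * τ * (n : ℕ) / N))
      (((Int.fract ((ℓ : ℚ) / N) - 1 / 2 : ℚ) : ℂ) - ω₁ / (2 * Real.pi * Complex.I) *
        heckeG' N (periodLattice ω₁ τ) (ω₁ * (ℓ * τ / N))) := by
  have hpoint : latticePoint ω₁ τ (ℓ, 0) / N = ω₁ * (ℓ * τ / N) := by
    rw [latticePoint_apply, Int.cast_zero, add_zero, mul_div_assoc]
  have h := hasSum_qExpansion hω₁ τ hℓ 0
  rw [hpoint] at h
  exact h.congr_fun fun n => by simp

include hω₁ hℓ in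
theorem hasSum_sum_neg_one_zpow_mul_sign_divisorsCongr (hN : Even N) :
    HasSum (fun n : ℕ+ => ((∑ m ∈ divisorsCongr N ℓ n,
          (-1 : ℚ) ^ (((n : ℕ) : ℤ) / m) * (m.sign : ℚ) : ℚ) : ℂ) *
        Complex.exp (2 * Real.pi * Complex.I * τ * (n : ℕ) / N))
      (((Int.fract ((ℓ : ℚ) / N) - 1 / 2 : ℚ) : ℂ) - ω₁ / (2 * Real.pi * Complex.I) *
        heckeG' N (periodLattice ω₁ τ) (ω₁ * (1 / 2 + ℓ * τ / N))) := by
  have hN0 : (N : ℂ) ≠ 0 := NeZero.ne _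
  obtain ⟨k, hk⟩ := hN
  have hkC : (N : ℂ) = k + k := by exact_mod_cast hk
  have hhalf : (((k : ℤ) : ℝ) / N) = 1 / 2 := by
    have hkR : (N : ℝ) = k + k := by exact_mod_cast hk
    rw [div_eq_div_iff (NeZero.ne _) two_ne_zero, hkR, Int.cast_natCast]
    ring
  have hpoint : latticePoint ω₁ τ (ℓ, k) / N = ω₁ * (1 / 2 + ℓ * τ / N) := by
    rw [latticePoint_apply, Int.cast_natCast]
    field_simp
    rw [hkC]
    ring
  have h := hasSum_qExpansion hω₁ τ hℓ k
  rw [hpoint, hhalf] at h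
  refine h.congr_fun fun n => ?_
  simp only [expTwoPiI_one_half_mul]
  push_cast
  rfl

/-- The coefficients of the expansion of `G'(L_τ, 2πiℓ/N)` in powers of `q^(1/N)` at the cusp
`τ = 0`. -/
def cuspCoeff (N : ℕ) (ℓ : ℤ) (n : ℕ) : ℚ :=
  if n = 0 then Int.fract ((ℓ : ℚ) / N) - 1 / 2
  else -((∑ m ∈ divisorsCongr N ℓ n, m.sign : ℤ) : ℚ)

include hℓ in
theorem hasSum_cuspCoeff :
    HasSum (fun n : ℕ => (cuspCoeff N ℓ n : ℂ) *
        Complex.exp (2 * Real.pi * Complex.I * τ * n / N))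
      ((τ : ℂ)⁻¹ * heckeG' N (tateLattice (-1 / (τ : ℂ))) (2 * Real.pi * Complex.I * (ℓ / N))) := by
  have hτ : (τ : ℂ) ≠ 0 := τ.ne_zero
  have hpi := Complex.two_pi_I_ne_zero
  have hpoint : 2 * Real.pi * Complex.I / τ * (ℓ * τ / N) =
      (2 * Real.pi * Complex.I * (ℓ / N) : ℂ) := by
    field_simp
  have h := (hasSum_sum_sign_divisorsCongr (div_ne_zero hpi hτ) τ hℓ).neg
  rw [hpoint, ← tateLattice_neg_one_div hτ, div_right_comm, div_self hpi, one_div (τ : ℂ),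
    neg_sub] at h
  rw [← hasSum_nat_add_iff' 1, ← Equiv.pnatEquivNat.hasSum_iff]
  simp only [Finset.sum_range_one]
  have hconst : (cuspCoeff N ℓ 0 : ℂ) * Complex.exp (2 * Real.pi * Complex.I * τ * (0 : ℕ) / N) =
      ((Int.fract ((ℓ : ℚ) / N) - 1 / 2 : ℚ) : ℂ) := by
    simp [cuspCoeff]
  rw [hconst]
  refine h.congr_fun fun n => ?_
  have hn : Equiv.pnatEquivNat n + 1 = (n : ℕ) := n.natPred_add_one
  rw [Function.comp_apply, hn, cuspCoeff, if_neg n.ne_zero, Rat.cast_neg, Rat.cast_intCast,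
    neg_mul]

end QExpansion

end HeckeEisenstein

end

theorem proposition4p1_general (N : ℕ) [NeZero N] (ℓ : ℤ) (hℓ : ¬ (N : ℤ) ∣ ℓ) :
    (∀ (τ : ℍ) (w : ℂ), (N : ℂ) * w ∈ HeckeEisenstein.tateLattice τ →
      ∃ F, HeckeEisenstein.IsHeckeContinuation N (HeckeEisenstein.tateLattice τ) w F) ∧
    (∀ τ : ℍ,
      Summable (fun n : ℕ+ =>
        ((∑ m ∈ HeckeEisenstein.divisorsCongr N ℓ n, m.sign : ℤ) : ℂ) *
          Complex.exp (2 * Real.pi * Complex.I * τ * (n : ℕ) / N)) ∧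
      HeckeEisenstein.heckeG' N (HeckeEisenstein.tateLattice τ)
          (2 * Real.pi * Complex.I * (ℓ * τ / N)) =
        (((Int.fract ((ℓ : ℚ) / N) - 1 / 2 : ℚ)) : ℂ) -
          ∑' n : ℕ+, ((∑ m ∈ HeckeEisenstein.divisorsCongr N ℓ n, m.sign : ℤ) : ℂ) *
            Complex.exp (2 * Real.pi * Complex.I * τ * (n : ℕ) / N)) ∧
    (Even N → ∀ τ : ℍ,
      Summable (fun n : ℕ+ =>
        ((∑ m ∈ HeckeEisenstein.divisorsCongr N ℓ n,
            (-1 : ℚ) ^ (((n : ℕ) : ℤ) / m) * (m.sign : ℚ) : ℚ) : ℂ) *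
          Complex.exp (2 * Real.pi * Complex.I * τ * (n : ℕ) / N)) ∧
      HeckeEisenstein.heckeG' N (HeckeEisenstein.tateLattice τ)
          (2 * Real.pi * Complex.I * (1 / 2 + ℓ * τ / N)) =
        (((Int.fract ((ℓ : ℚ) / N) - 1 / 2 : ℚ)) : ℂ) -
          ∑' n : ℕ+, ((∑ m ∈ HeckeEisenstein.divisorsCongr N ℓ n,
              (-1 : ℚ) ^ (((n : ℕ) : ℤ) / m) * (m.sign : ℚ) : ℚ) : ℂ) *
            Complex.exp (2 * Real.pi * Complex.I * τ * (n : ℕ) / N)) ∧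
    (∃ c : ℕ → ℚ, ∀ τ : ℍ,
      HasSum (fun n : ℕ => (c n : ℂ) * Complex.exp (2 * Real.pi * Complex.I * τ * n / N))
        ((τ : ℂ)⁻¹ * HeckeEisenstein.heckeG' N (HeckeEisenstein.tateLattice (-1 / (τ : ℂ)))
          (2 * Real.pi * Complex.I * (ℓ / N)))) := by
  have hpi := Complex.two_pi_I_ne_zero
  refine ⟨fun τ w hw => ?_, fun τ => ?_, fun hN τ => ?_, HeckeEisenstein.cuspCoeff N ℓ, fun τ =>
    HeckeEisenstein.hasSum_cuspCoeff τ hℓ⟩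
  · rw [HeckeEisenstein.tateLattice_eq_periodLattice] at hw ⊢
    exact HeckeEisenstein.exists_isHeckeContinuation hpi τ hw
  · have h := HeckeEisenstein.hasSum_sum_sign_divisorsCongr hpi τ hℓ
    rw [div_self hpi, one_mul, ← HeckeEisenstein.tateLattice_eq_periodLattice] at h
    exact ⟨h.summable, by rw [h.tsum_eq, sub_sub_cancel]⟩
  · have h := HeckeEisenstein.hasSum_sum_neg_one_zpow_mul_sign_divisorsCongr hpi τ hℓ hN
    rw [div_self hpi, one_mul, ← HeckeEisenstein.tateLattice_eq_periodLattice] at h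
    exact ⟨h.summable, by rw [h.tsum_eq, sub_sub_cancel]⟩

theorem proposition4p1 (N : ℕ) (hN : 2 ≤ N) (ℓ : ℤ) (hℓ : IsCoprime ℓ (N : ℤ)) :
    -- Hecke's continuation exists for all the series that enter
    (∀ (τ : ℍ) (w : ℂ), (N : ℂ) * w ∈ HeckeEisenstein.tateLattice τ →
      ∃ F, HeckeEisenstein.IsHeckeContinuation N (HeckeEisenstein.tateLattice τ) w F) ∧
    -- (a)
    (∀ τ : ℍ,
      Summable (fun n : ℕ+ =>
        ((∑ m ∈ HeckeEisenstein.divisorsCongr N ℓ n, m.sign : ℤ) : ℂ) *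
          Complex.exp (2 * Real.pi * Complex.I * τ * (n : ℕ) / N)) ∧
      HeckeEisenstein.heckeG' N (HeckeEisenstein.tateLattice τ)
          (2 * Real.pi * Complex.I * (ℓ * τ / N)) =
        (((Int.fract ((ℓ : ℚ) / N) - 1 / 2 : ℚ)) : ℂ) -
          ∑' n : ℕ+, ((∑ m ∈ HeckeEisenstein.divisorsCongr N ℓ n, m.sign : ℤ) : ℂ) *
            Complex.exp (2 * Real.pi * Complex.I * τ * (n : ℕ) / N)) ∧
    -- (b)
    (Even N → ∀ τ : ℍ,
      Summable (fun n : ℕ+ =>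
        ((∑ m ∈ HeckeEisenstein.divisorsCongr N ℓ n,
            (-1 : ℚ) ^ (((n : ℕ) : ℤ) / m) * (m.sign : ℚ) : ℚ) : ℂ) *
          Complex.exp (2 * Real.pi * Complex.I * τ * (n : ℕ) / N)) ∧
      HeckeEisenstein.heckeG' N (HeckeEisenstein.tateLattice τ)
          (2 * Real.pi * Complex.I * (1 / 2 + ℓ * τ / N)) =
        (((Int.fract ((ℓ : ℚ) / N) - 1 / 2 : ℚ)) : ℂ) -
          ∑' n : ℕ+, ((∑ m ∈ HeckeEisenstein.divisorsCongr N ℓ n,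
              (-1 : ℚ) ^ (((n : ℕ) : ℤ) / m) * (m.sign : ℚ) : ℚ) : ℂ) *
            Complex.exp (2 * Real.pi * Complex.I * τ * (n : ℕ) / N)) ∧
    -- the expansion at the cusp `τ = 0` of the weight one form
    -- `f(τ) = G'(ℤ·2πi + ℤ·2πiτ, 2πi ℓ / N)` has rational coefficients
    (∃ c : ℕ → ℚ, ∀ τ : ℍ,
      HasSum (fun n : ℕ => (c n : ℂ) * Complex.exp (2 * Real.pi * Complex.I * τ * n / N))
        ((τ : ℂ)⁻¹ * HeckeEisenstein.heckeG' N (HeckeEisenstein.tateLattice (-1 / (τ : ℂ)))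
          (2 * Real.pi * Complex.I * (ℓ / N)))) := by
  have : NeZero N := ⟨by omega⟩
  exact proposition4p1_general N ℓ fun hdvd => by
    have := Int.isUnit_iff.1 (hℓ.isUnit_of_dvd' hdvd dvd_rfl)
    omega
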